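/- **Setting.** An arm is a Markov decision process with finite state space $\mathbb S$, action set $\mathbb A=\{0,1\}$, transition kernel $P(s,a,\cdot)$ and reward $r(s,a)$. Assume it is unichain: under every randomized stationary policy $\bar\pi(a|s)$ the induced Markov chain on $\mathbb S$ has a single recurrent class. Let $0<\alpha<1$. *Single-armed problem.* $V_1^{\bar\pi}=\lim_T \frac1T\sum_{t<T}\mathbb E[r(S(t),A(t))]$ is the long-run average reward of $\bar\pi$ (a limit which exists and does not depend on the initial state). $\bar\pi$ satisfies the relaxed budget constraint if $\lim_T\frac1T\sum_{t<T}\mathbb E[A(t)]=\alpha$; it is optimal if it maximizes $V_1^{\bar\pi}$ under this constraint. *$N$-armed problem.* There are $N\ge1$ arms with $\alpha N$ an integer; exactly $\alpha N$ arms must be activated (action $1$) at each time. $V_N^\pi$ is the long-run average expected reward per arm of a (history-dependent, randomized) policy $\pi$, and $V_N^*$ is its supremum over all policies that satisfy the budget constraint, from any given initial state (the upper limit of the averages is used for policies whose averages do not converge). *$\mathrm{FTVA}(\bar\pi)$.* Each arm $i$ has a real state $S_i(t)$, with arbitrary $S_i(0)$, and a virtual state $\hat S_i(t)$, where the $\hat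 S_i(0)$ are i.i.d. from the stationary distribution of $\bar\pi$. At each time virtual actions $\hat A_i(t)\sim\bar\pi(\cdot|\hat S_i(t))$ are sampled independently. If $\sum_i\hat A_i(t)\ge\alpha N$, then $\alpha N$ arms among those with $\hat A_i(t)=1$ are activated; otherwise all arms with $\hat A_i(t)=1$ and $\alpha N-\sum_i\hat A_i(t)$ further ones are activated (with any, possibly randomized and history-dependent, tie-breaking rule). The arms then move independently by $P$; if $(S_i(t),A_i(t))=(\hat S_i(t),\hat A_i(t))$ then $\hat S_i(t+1)=S_i(t+1)$, and otherwise $\hat S_i(t+1)$ is sampled independently from $P(\hat S_i(t),\hat A_i(t),\cdot)$. $V_N^{\mathrm{FTVA}(\bar\pi)}$ is the long-run average expected reward per arm; if the tie-breaking rule depends only on the current real states, virtual states and virtual actions, the limit exists, and for general rules the lower limit of the averages is meant. *Synchronization.* In the leader-and-follower system two arms start with states and actions $(S(0),A(0),\hat S(0),\hat A(0))=(s,a,\hat s,\hat a)$. At times $t\ge1$ the leader chooses $\hat A(t)\sim\bar\pi(\cdot|\hat S(t))$ and the follower takes $A(t)=\hat A(t)$. If the two arms agree in state and action at time $t$, they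 move to the same sampled state; otherwise they move independently by $P$. The synchronization time $\tau^{\rm sync}(s,a,\hat s,\hat a)$ is the first $t\ge0$ with $(S(t),A(t))=(\hat S(t),\hat A(t))$. The policy $\bar\pi$ satisfies the Synchronization Assumption (SA) if $\mathbb E[\tau^{\rm sync}(s,a,\hat s,\hat a)]<\infty$ for all $(s,a,\hat s,\hat a)$. Put $r_{\max}=\max_{s,a}|r(s,a)|$ and $\bar\tau^{\rm sync}_{\max}=\max_{s,a,\hat s,\hat a}\mathbb E[\tau^{\rm sync}(s,a,\hat s,\hat a)]$. **Theorem.** Let $\bar\pi$ be any single-armed policy that satisfies the relaxed budget constraint and SA. Then for every $N\ge1$ with $\alpha N$ an integer, $$V_1^{\bar\pi}-V_N^{\mathrm{FTVA}(\bar\pi)}\le\frac{r_{\max}\,\bar\tau^{\rm sync}_{\max}}{\sqrt N}.$$ Consequently, if $\bar\pi^*$ is an optimal single-armed policy that satisfies SA, then for every such $N$ $$V_N^*-V_N^{\mathrm{FTVA}(\bar\pi^*)}\le V_1^{\bar\pi^*}-V_N^{\mathrm{FTVA}(\bar\pi^*)}\le\frac{r_{\max}\,\bar\tau^{\rm sync}_{\max}}{\sqrt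 N}.$$ -/

import Mathlib

open Filter Topology
open scoped ENNReal

namespace RestlessBandit

/-! ### Finite probability and time averages -/

/-- The joint law of independent coordinates with laws `p i`. -/
noncomputable def indep {ι X : Type*} [Fintype ι] [DecidableEq ι] [Fintype X]
    (p : ι → PMF X) : PMF (ι → X) :=
  PMF.ofFintype (fun f => ∏ i, p i (f i)) (by
    have h : ∀ i, ∑ x, p i x = 1 := fun i => by
      rw [← tsum_fintype (L := SummationFilter.unconditional X)]
      exact (p i).tsum_coe
    have h2 := Finset.prod_univ_sum (fun _ : ι => (Finset.univ : Finset X)) (fun i x => p i x)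
    rw [Fintype.piFinset_univ] at h2
    rw [← h2]
    simp [h])

/-- The expectation of a real function of a random element of a finite type. -/
noncomputable def expect {X : Type*} [Fintype X] (p : PMF X) (f : X → ℝ) : ℝ :=
  ∑ x, (p x).toReal * f x

/-- The time average `(1 / T) * (u 0 + ... + u (T - 1))`. -/
noncomputable def timeAvg (u : ℕ → ℝ) (T : ℕ) : ℝ :=
  (∑ t ∈ Finset.range T, u t) / T

/-- `v` is the long-run average `lim_{T → ∞} (1 / T) * (u 0 + ... + u (T - 1))`. -/
def HasAverage (u : ℕ → ℝ) (v : ℝ) : Prop :=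
  Tendsto (timeAvg u) atTop (𝓝 v)

/-! ### A single arm -/

/-- An arm: an MDP with state space `S` and action set `Bool`, where `true` is the active action
(`1`) and `false` the passive one (`0`). -/
structure ArmMDP (S : Type*) where
  /-- `P s a` is the law of the next state after action `a` in state `s`. -/
  P : S → Bool → PMF S
  /-- `r s a` is the reward for action `a` in state `s`. -/
  r : S → Bool → ℝ

/-- A (randomized) single-armed policy: `π s` is the law of the action taken in state `s`. -/
abbrev SinglePolicy (S : Type*) := S → PMF Bool

/-- The transition kernel of the Markov chain on states induced by a policy. -/
noncomputable def chain {S : Type*} (M : ArmMDP S) (π : SinglePolicy S) (s : S) : PMF S :=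
  (π s).bind (M.P s)

/-- `y` can be reached from `x` (in zero or more steps) under the policy `π`. -/
def Reaches {S : Type*} (M : ArmMDP S) (π : SinglePolicy S) : S → S → Prop :=
  Relation.ReflTransGen (fun x y => y ∈ (chain M π x).support)

/-- A recurrent class of the chain induced by `π`: a nonempty set of states such that exactly the
states of the set are reachable from any state of it. -/
def IsRecurrentClass {S : Type*} (M : ArmMDP S) (π : SinglePolicy S) (C : Set S) : Prop :=
  C.Nonempty ∧ ∀ x ∈ C, ∀ y, Reaches M π x y ↔ y ∈ C

/-- The unichain assumption: under every policy the induced chain has a single recurrent class. -/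
def Unichain {S : Type*} (M : ArmMDP S) : Prop :=
  ∀ π : SinglePolicy S, ∃! C : Set S, IsRecurrentClass M π C

/-- `μ` is a stationary state distribution of the policy `π`. -/
def IsStationary {S : Type*} (M : ArmMDP S) (π : SinglePolicy S) (μ : PMF S) : Prop :=
  μ.bind (chain M π) = μ

/-- The law of the state at time `t`, starting from state `s`. -/
noncomputable def singleStateLaw {S : Type*} (M : ArmMDP S) (π : SinglePolicy S) (s : S) :
    ℕ → PMF S
  | 0 => PMF.pure s
  | t + 1 => (singleStateLaw M π s t).bind (chain M π)

/-- The law of the state and action at time `t`, starting from state `s`. -/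
noncomputable def singleLaw {S : Type*} (M : ArmMDP S) (π : SinglePolicy S) (s : S) (t : ℕ) :
    PMF (S × Bool) :=
  (singleStateLaw M π s t).bind fun x => (π x).map fun a => (x, a)

/-- The expected reward at time `t`. -/
noncomputable def singleReward {S : Type*} [Fintype S] (M : ArmMDP S) (π : SinglePolicy S)
    (s : S) (t : ℕ) : ℝ :=
  expect (singleLaw M π s t) fun z => M.r z.1 z.2

/-- The expected action (the probability of activation) at time `t`. -/
noncomputable def singleActivation {S : Type*} [Fintype S] (M : ArmMDP S) (π : SinglePolicy S)
    (s : S) (t : ℕ) : ℝ :=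
  expect (singleLaw M π s t) fun z => if z.2 = true then 1 else 0

/-- The relaxed budget constraint: the long-run average rate of activation is `α`. -/
def RelaxedBudget {S : Type*} [Fintype S] (M : ArmMDP S) (α : ℝ) (π : SinglePolicy S) : Prop :=
  ∀ s, HasAverage (singleActivation M π s) α

/-- `π` is an optimal single-armed policy: it maximizes the long-run average reward subject to
the relaxed budget constraint. -/
def IsOptimalSingle {S : Type*} [Fintype S] (M : ArmMDP S) (α : ℝ) (π : SinglePolicy S) : Prop :=
  RelaxedBudget M α π ∧
    ∃ v, (∀ s, HasAverage (singleReward M π s) v) ∧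
      ∀ π', RelaxedBudget M α π' → ∀ s v', HasAverage (singleReward M π' s) v' → v' ≤ v

/-- `r_max = max |r s a|`. -/
noncomputable def rMax {S : Type*} (M : ArmMDP S) : ℝ := ⨆ z : S × Bool, |M.r z.1 z.2|

/-! ### The leader-and-follower system -/

/-- One transition of a pair of arms with state-action pairs `z` and `w`: the next states are the
same sample if the two pairs agree, and are sampled independently otherwise. -/
noncomputable def couple {S : Type*} [DecidableEq S] (M : ArmMDP S) (z w : S × Bool) :
    PMF (S × S) :=
  if z = w then (M.P z.1 z.2).map fun x => (x, x)
  else (M.P z.1 z.2).bind fun x => (M.P w.1 w.2).map fun y => (x, y)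

/-- One step of the leader-and-follower system. The state is (follower, leader), each with its
state and action. The leader chooses its new action by `π`, and the follower copies it. -/
noncomputable def lfStep {S : Type*} [DecidableEq S] (M : ArmMDP S) (π : SinglePolicy S)
    (c : (S × Bool) × (S × Bool)) : PMF ((S × Bool) × (S × Bool)) :=
  (couple M c.1 c.2).bind fun x => (π x.2).map fun a => ((x.1, a), (x.2, a))

/-- The law of the trajectory at times `0, ..., t` of the leader-and-follower system with initial
states and actions `c`. -/
noncomputable def lfPath {S : Type*} [DecidableEq S] (M : ArmMDP S) (π : SinglePolicy S) :
    ℕ → (S × Bool) × (S × Bool) → PMF (List ((S × Bool) × (S × Bool)))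
  | 0, c => PMF.pure [c]
  | t + 1, c => (lfStep M π c).bind fun c' => (lfPath M π t c').map fun l => c :: l

/-- The probability that the synchronization time exceeds `t`. The synchronization time is the
first time at which the two arms agree in state and action. As the actions agree at all times
`t ≥ 1`, it is the first time at which the states agree, except that two arms which start in the
same state with different actions (and so may separate) do not count as synchronized at time `0`. -/
noncomputable def syncTail {S : Type*} [DecidableEq S] (M : ArmMDP S) (π : SinglePolicy S)
    (c : (S × Bool) × (S × Bool)) (t : ℕ) : ℝ≥0∞ :=
  (lfPath M π t c).toOuterMeasure {l | ∀ d ∈ l, d.1 ≠ d.2}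

/-- The expected synchronization time `E[τ] = ∑_{t ≥ 0} P(τ > t)`. -/
noncomputable def expSyncTime {S : Type*} [DecidableEq S] (M : ArmMDP S) (π : SinglePolicy S)
    (c : (S × Bool) × (S × Bool)) : ℝ≥0∞ :=
  ∑' t, syncTail M π c t

/-- The Synchronization Assumption: the expected synchronization time is finite for all initial
states and actions. -/
def SyncAssumption {S : Type*} [DecidableEq S] (M : ArmMDP S) (π : SinglePolicy S) : Prop :=
  ∀ c, expSyncTime M π c < ∞

/-- The largest expected synchronization time over all initial states and actions. -/
noncomputable def maxSyncTime {S : Type*} [DecidableEq S] (M : ArmMDP S) (π : SinglePolicy S) :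
    ℝ :=
  (⨆ c, expSyncTime M π c).toReal

/-! ### The `N`-armed problem -/

/-- The number of activated arms. -/
def numActive {N : ℕ} (a : Fin N → Bool) : ℕ := (Finset.univ.filter fun i => a i = true).card

/-- The average reward per arm. -/
noncomputable def armReward {S : Type*} (M : ArmMDP S) {N : ℕ} (x : Fin N → S)
    (a : Fin N → Bool) : ℝ :=
  (1 / N) * ∑ i, M.r (x i) (a i)

/-- A (randomized, history-dependent) `N`-armed policy: it maps the past states and actions
(latest first) and the current state to the law of the joint action. -/
abbrev Policy (N : ℕ) (S : Type*) :=
  List ((Fin N → S) × (Fin N → Bool)) → (Fin N → S) → PMF (Fin N → Bool)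

/-- The joint law of the past states and actions and the state at time `t`, from `s₀`. -/
noncomputable def historyLaw {S : Type*} [Fintype S] (M : ArmMDP S) {N : ℕ} (σ : Policy N S)
    (s₀ : Fin N → S) : ℕ → PMF (List ((Fin N → S) × (Fin N → Bool)) × (Fin N → S))
  | 0 => PMF.pure ([], s₀)
  | t + 1 => (historyLaw M σ s₀ t).bind fun h =>
      (σ h.1 h.2).bind fun a =>
        (indep fun i => M.P (h.2 i) (a i)).map fun x => ((h.2, a) :: h.1, x)

/-- The law of the system state and the joint action at time `t`, from `s₀`. -/
noncomputable def policyLaw {S : Type*} [Fintype S] (M : ArmMDP S) {N : ℕ} (σ : Policy N S)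
    (s₀ : Fin N → S) (t : ℕ) : PMF ((Fin N → S) × (Fin N → Bool)) :=
  (historyLaw M σ s₀ t).bind fun h => (σ h.1 h.2).map fun a => (h.2, a)

/-- The budget constraint: from `s₀`, exactly `K` arms are activated at every time. -/
def Admissible {S : Type*} [Fintype S] (M : ArmMDP S) {N : ℕ} (K : ℕ) (s₀ : Fin N → S)
    (σ : Policy N S) : Prop :=
  ∀ t, ∀ z ∈ (policyLaw M σ s₀ t).support, numActive z.2 = K

/-- The expected reward per arm at time `t` under a policy. -/
noncomputable def policyReward {S : Type*} [Fintype S] (M : ArmMDP S) {N : ℕ} (σ : Policy N S)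
    (s₀ : Fin N → S) (t : ℕ) : ℝ :=
  expect (policyLaw M σ s₀ t) fun z => armReward M z.1 z.2

/-- The optimal value from `s₀`: the supremum of the long-run average reward per arm over all
policies that satisfy the budget constraint. Policies without a limiting average are included,
with the upper limit as their value. -/
noncomputable def optValue {S : Type*} [Fintype S] (M : ArmMDP S) {N : ℕ} (K : ℕ)
    (s₀ : Fin N → S) : ℝ :=
  sSup {v | ∃ σ : Policy N S, Admissible M K s₀ σ ∧
    v = limsup (timeAvg (policyReward M σ s₀)) atTop}

/-! ### Follow-the-Virtual-Advice -/

/-- What happened at one time: real states, virtual states, virtual actions, real actions. -/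
abbrev Record (N : ℕ) (S : Type*) :=
  (Fin N → S) × (Fin N → S) × (Fin N → Bool) × (Fin N → Bool)

/-- A tie-breaking rule: from the past (latest first), the current real states, virtual states
and virtual actions it produces the law of the real actions. -/
abbrev TieRule (N : ℕ) (S : Type*) :=
  List (Record N S) → (Fin N → S) → (Fin N → S) → (Fin N → Bool) → PMF (Fin N → Bool)

/-- The rule activates exactly `K` arms: `K` arms among those with virtual action `1` if there are
at least `K` of them, and otherwise all of these together with some other arms. -/
def TieRule.Valid {N : ℕ} {S : Type*} (K : ℕ) (ρ : TieRule N S) : Prop :=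
  ∀ h x y b, ∀ a ∈ (ρ h x y b).support, numActive a = K ∧
    (K ≤ numActive b → ∀ i, a i = true → b i = true) ∧
    (numActive b < K → ∀ i, b i = true → a i = true)

/-- The rule uses only the current real states, virtual states and virtual actions. -/
def TieRule.Markov {N : ℕ} {S : Type*} (ρ : TieRule N S) : Prop :=
  ∃ g : (Fin N → S) → (Fin N → S) → (Fin N → Bool) → PMF (Fin N → Bool),
    ∀ h x y b, ρ h x y b = g x y b

/-- The law, given the past and the current real states `x` and virtual states `y`, of the virtual
actions and the real actions: the virtual actions are sampled independently from `π`. -/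
noncomputable def ftvaActions {N : ℕ} {S : Type*} (π : SinglePolicy S) (ρ : TieRule N S)
    (h : List (Record N S)) (x y : Fin N → S) : PMF ((Fin N → Bool) × (Fin N → Bool)) :=
  (indep fun i => π (y i)).bind fun b => (ρ h x y b).map fun a => (b, a)

/-- The joint law of the past and of the real and virtual states at time `t` under FTVA. The real
states start at `s₀`, the virtual ones are i.i.d. from `μ`. The arms move independently; the
real and virtual state of an arm move together if they agree in state and action, and
independently otherwise. -/
noncomputable def ftvaHistoryLaw {S : Type*} [Fintype S] [DecidableEq S] (M : ArmMDP S)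
    (π : SinglePolicy S) (μ : PMF S) {N : ℕ} (ρ : TieRule N S) (s₀ : Fin N → S) :
    ℕ → PMF (List (Record N S) × (Fin N → S) × (Fin N → S))
  | 0 => (indep fun _ : Fin N => μ).map fun y => ([], s₀, y)
  | t + 1 => (ftvaHistoryLaw M π μ ρ s₀ t).bind fun h =>
      (ftvaActions π ρ h.1 h.2.1 h.2.2).bind fun ba =>
        (indep fun i => couple M (h.2.1 i, ba.2 i) (h.2.2 i, ba.1 i)).map fun q =>
          ((h.2.1, h.2.2, ba.1, ba.2) :: h.1, fun i => (q i).1, fun i => (q i).2)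

/-- The law of the real states and real actions at time `t` under FTVA. -/
noncomputable def ftvaLaw {S : Type*} [Fintype S] [DecidableEq S] (M : ArmMDP S)
    (π : SinglePolicy S) (μ : PMF S) {N : ℕ} (ρ : TieRule N S) (s₀ : Fin N → S) (t : ℕ) :
    PMF ((Fin N → S) × (Fin N → Bool)) :=
  (ftvaHistoryLaw M π μ ρ s₀ t).bind fun h =>
    (ftvaActions π ρ h.1 h.2.1 h.2.2).map fun ba => (h.2.1, ba.2)

/-- The expected reward per arm at time `t` under FTVA. -/
noncomputable def ftvaReward {S : Type*} [Fintype S] [DecidableEq S] (M : ArmMDP S)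
    (π : SinglePolicy S) (μ : PMF S) {N : ℕ} (ρ : TieRule N S) (s₀ : Fin N → S) (t : ℕ) : ℝ :=
  expect (ftvaLaw M π μ ρ s₀ t) fun z => armReward M z.1 z.2

/-- The long-run average reward per arm of FTVA, as a lower limit, so that it also makes sense
when a history-dependent tie-breaking rule prevents the averages from converging. -/
noncomputable def ftvaValue {S : Type*} [Fintype S] [DecidableEq S] (M : ArmMDP S)
    (π : SinglePolicy S) (μ : PMF S) {N : ℕ} (ρ : TieRule N S) (s₀ : Fin N → S) : ℝ :=
  liminf (timeAvg (ftvaReward M π μ ρ s₀)) atTop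

end RestlessBandit

open RestlessBandit

/-! ### Follow-the-Virtual-Advice loses at most `rMax * maxSyncTime / √N`

Call an arm unsynchronized when its real state-action pair differs from the virtual one. FTVA earns
what the virtual process earns up to `2 * rMax / N` per unsynchronized arm. The virtual process
consists of `N` independent stationary copies of the single-armed chain
(`recordLaw_map_virtual`), so it earns exactly `V₁` per arm, and its number of virtual activations
has mean `α N` and standard deviation at most `√N / 2`. FTVA deviates from the virtual actions on
exactly `|∑ i, b i - α N|` arms, hence on at most `√N / 2` of them in expectation
(`expect_disagree_le`).

The number of unsynchronized arms is controlled by a drift argument. Let `g c` be the expected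
synchronization time of the leader-and-follower system from `c`. Between two deviations an arm and
its virtual copy form such a system, so `∑ i, g (armPairs z i)` falls in expectation by the number of
unsynchronized arms, and rises by at most `maxSyncTime` per deviation (`potential_succ_le`). Its
boundedness shows that the number of unsynchronized arms is on average at most
`maxSyncTime * √N / 2`, which is the bound of `sub_ftvaValue_le`.

The remaining ingredients concern finite Markov chains. Time averages converge because functions
split into a harmonic part and a part in the range of `T - 1`, with `T` the Markov operator
(`exists_harmonic_hasAverage`); in the unichain case harmonic functions are constant. For the upper
bound on `optValue`, a limit point of the time-averaged occupation measures of an `N`-armed policy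
is the state-action law of a stationary single-armed policy which satisfies the relaxed budget
constraint and earns at least as much (`limsup_timeAvg_policyReward_le`).
-/

namespace RestlessBandit

/-! ### Expectations and independence -/

theorem sum_toReal_eq_one {X : Type*} [Fintype X] (p : PMF X) : ∑ x, (p x).toReal = 1 := by
  rw [← ENNReal.toReal_sum fun x _ => p.apply_ne_top x,
    ← tsum_fintype (L := SummationFilter.unconditional X), p.tsum_coe, ENNReal.toReal_one]

theorem toReal_bind_apply {X Y : Type*} [Fintype X] (p : PMF X) (κ : X → PMF Y) (y : Y) :
    ((p.bind κ) y).toReal = ∑ x, (p x).toReal * (κ x y).toReal := by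
  rw [PMF.bind_apply, tsum_fintype, ENNReal.toReal_sum fun x _ =>
    ENNReal.mul_ne_top (p.apply_ne_top x) ((κ x).apply_ne_top y)]
  simp

theorem expect_bind {X Y : Type*} [Fintype X] [Fintype Y] (p : PMF X) (κ : X → PMF Y)
    (f : Y → ℝ) : expect (p.bind κ) f = expect p fun x => expect (κ x) f := by
  simp only [expect, toReal_bind_apply, Finset.sum_mul, Finset.mul_sum]
  rw [Finset.sum_comm]
  simp only [mul_assoc]

theorem expect_pure {X : Type*} [Fintype X] (x : X) (f : X → ℝ) :
    expect (PMF.pure x) f = f x := by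
  classical
  rw [expect, Finset.sum_eq_single x]
  · simp
  · intro y _ hy
    simp [hy]
  · simp

theorem expect_map {X Y : Type*} [Fintype X] [Fintype Y] (p : PMF X) (g : X → Y) (f : Y → ℝ) :
    expect (p.map g) f = expect p fun x => f (g x) := by
  rw [← PMF.bind_pure_comp, expect_bind]
  simp [expect_pure]

theorem expect_const {X : Type*} [Fintype X] (p : PMF X) (c : ℝ) :
    expect p (fun _ => c) = c := by
  rw [expect, ← Finset.sum_mul, sum_toReal_eq_one, one_mul]

theorem expect_add {X : Type*} [Fintype X] (p : PMF X) (f g : X → ℝ) :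
    expect p (fun x => f x + g x) = expect p f + expect p g := by
  simp only [expect, mul_add, Finset.sum_add_distrib]

theorem expect_sub {X : Type*} [Fintype X] (p : PMF X) (f g : X → ℝ) :
    expect p (fun x => f x - g x) = expect p f - expect p g := by
  simp only [expect, mul_sub, Finset.sum_sub_distrib]

theorem expect_const_mul {X : Type*} [Fintype X] (p : PMF X) (c : ℝ) (f : X → ℝ) :
    expect p (fun x => c * f x) = c * expect p f := by
  simp only [expect, Finset.mul_sum, mul_left_comm]

theorem expect_sum {X ι : Type*} [Fintype X] (p : PMF X) (s : Finset ι) (f : ι → X → ℝ) :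
    expect p (fun x => ∑ i ∈ s, f i x) = ∑ i ∈ s, expect p (f i) := by
  simp only [expect, Finset.mul_sum]
  rw [Finset.sum_comm]

theorem expect_mono {X : Type*} [Fintype X] (p : PMF X) {f g : X → ℝ}
    (h : ∀ x ∈ p.support, f x ≤ g x) : expect p f ≤ expect p g := by
  refine Finset.sum_le_sum fun x _ => ?_
  by_cases hx : x ∈ p.support
  · exact mul_le_mul_of_nonneg_left (h x hx) ENNReal.toReal_nonneg
  · simp [(PMF.apply_eq_zero_iff p x).2 hx]

theorem expect_congr {X : Type*} [Fintype X] (p : PMF X) {f g : X → ℝ}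
    (h : ∀ x ∈ p.support, f x = g x) : expect p f = expect p g :=
  le_antisymm (expect_mono p fun x hx => (h x hx).le) (expect_mono p fun x hx => (h x hx).ge)

theorem expect_indicator {X : Type*} [Fintype X] [DecidableEq X] (p : PMF X) (x : X) :
    expect p (fun y => if y = x then 1 else 0) = (p x).toReal := by
  simp [expect]

theorem pmf_ext_expect {X : Type*} [Fintype X] {p q : PMF X}
    (h : ∀ f : X → ℝ, expect p f = expect q f) : p = q := by
  classical
  ext x
  rw [← ENNReal.toReal_eq_toReal_iff' (p.apply_ne_top x) (q.apply_ne_top x),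
    ← expect_indicator, ← expect_indicator, h]

theorem sq_expect_le {X : Type*} [Fintype X] (p : PMF X) (f : X → ℝ) :
    expect p f ^ 2 ≤ expect p fun x => f x ^ 2 := by
  have h : 0 ≤ expect p fun x => (f x - expect p f) ^ 2 := by
    have := expect_mono p (f := fun _ => 0) (g := fun x => (f x - expect p f) ^ 2)
      fun x _ => sq_nonneg _
    rwa [expect_const] at this
  have h2 : (fun x => (f x - expect p f) ^ 2)
      = fun x => f x ^ 2 - (2 * expect p f * f x - expect p f ^ 2) := by
    funext x; ring
  rw [h2, expect_sub, expect_sub, expect_const_mul, expect_const] at h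
  nlinarith

theorem pmf_map_const {X Y : Type*} (p : PMF X) (y : Y) : p.map (fun _ => y) = PMF.pure y :=
  PMF.map_const p y

theorem toReal_indep_apply {ι X : Type*} [Fintype ι] [DecidableEq ι] [Fintype X]
    (p : ι → PMF X) (f : ι → X) : (indep p f).toReal = ∏ i, (p i (f i)).toReal := by
  rw [indep, PMF.ofFintype_apply, ENNReal.toReal_prod]

theorem expect_indep_prod {ι X : Type*} [Fintype ι] [DecidableEq ι] [Fintype X]
    (p : ι → PMF X) (h : ι → X → ℝ) :
    expect (indep p) (fun f => ∏ i, h i (f i)) = ∏ i, expect (p i) (h i) := by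
  have := Finset.prod_univ_sum (fun _ : ι => (Finset.univ : Finset X))
    (fun i x => (p i x).toReal * h i x)
  rw [Fintype.piFinset_univ] at this
  simp only [expect, this, toReal_indep_apply, Finset.prod_mul_distrib]

/-- The coordinates of `indep p` have the laws `p i`. -/
theorem expect_indep_apply {ι X : Type*} [Fintype ι] [DecidableEq ι] [Fintype X]
    (p : ι → PMF X) (i : ι) (h : X → ℝ) :
    expect (indep p) (fun f => h (f i)) = expect (p i) h := by
  have := expect_indep_prod p fun j x => if j = i then h x else 1
  simp only [Finset.prod_ite_eq', Finset.mem_univ, if_true] at this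
  rw [this, Finset.prod_eq_single i]
  · simp
  · intro j _ hj
    simp [hj, expect_const]
  · simp

theorem expect_indep_mul {ι X : Type*} [Fintype ι] [DecidableEq ι] [Fintype X]
    (p : ι → PMF X) {i j : ι} (hij : i ≠ j) (h h' : X → ℝ) :
    expect (indep p) (fun f => h (f i) * h' (f j)) = expect (p i) h * expect (p j) h' := by
  have := expect_indep_prod p fun k x => (if k = i then h x else 1) * (if k = j then h' x else 1)
  simp only [Finset.prod_mul_distrib, Finset.prod_ite_eq', Finset.mem_univ, if_true] at this
  rw [this, Finset.prod_eq_mul i j hij]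
  · simp [hij, hij.symm]
  · rintro k _ ⟨hk, hk'⟩
    simp [hk, hk', expect_const]
  · simp
  · simp

/-- The variance of a sum of independent centred variables is the sum of the variances. -/
theorem expect_indep_sum_sq {ι X : Type*} [Fintype ι] [DecidableEq ι] [Fintype X]
    (p : ι → PMF X) (h : X → ℝ) (h0 : ∀ i, expect (p i) h = 0) :
    expect (indep p) (fun f => (∑ i, h (f i)) ^ 2) = ∑ i, expect (p i) fun x => h x ^ 2 := by
  simp only [sq, Finset.sum_mul_sum, expect_sum]
  refine Finset.sum_congr rfl fun i _ => ?_
  rw [Finset.sum_eq_single i]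
  · exact expect_indep_apply p i fun x => h x * h x
  · intro j _ hj
    rw [expect_indep_mul p hj.symm, h0, zero_mul]
  · simp

/-- Independent coordinates that move by independent kernels stay independent. -/
theorem indep_bind {ι X Y : Type*} [Fintype ι] [DecidableEq ι] [Fintype X] [Fintype Y]
    (p : ι → PMF X) (κ : ι → X → PMF Y) :
    ((indep p).bind fun f => indep fun i => κ i (f i)) = indep fun i => (p i).bind (κ i) := by
  ext g
  rw [← ENNReal.toReal_eq_toReal_iff' (PMF.apply_ne_top _ _) (PMF.apply_ne_top _ _),
    toReal_bind_apply]
  simp only [toReal_indep_apply, toReal_bind_apply]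
  have := expect_indep_prod p fun i x => (κ i x (g i)).toReal
  simpa only [expect, toReal_indep_apply] using this

theorem indep_pure {ι X : Type*} [Fintype ι] [DecidableEq ι] [Fintype X] (x : ι → X) :
    (indep fun i => PMF.pure (x i)) = PMF.pure x := by
  classical
  ext g
  rw [indep, PMF.ofFintype_apply, PMF.pure_apply]
  split_ifs with h
  · simp [h]
  · obtain ⟨i, hi⟩ := Function.ne_iff.1 h
    exact Finset.prod_eq_zero (Finset.mem_univ i) (by simp [hi])

theorem indep_map {ι X Y : Type*} [Fintype ι] [DecidableEq ι] [Fintype X] [Fintype Y]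
    (p : ι → PMF X) (g : ι → X → Y) :
    ((indep p).map fun f i => g i (f i)) = indep fun i => (p i).map (g i) := by
  simp only [← PMF.bind_pure_comp, Function.comp_def]
  rw [← indep_bind]
  simp only [indep_pure]

/-! ### Finite Markov chains -/

theorem abs_expect_le {X : Type*} [Fintype X] (p : PMF X) {f : X → ℝ} {C : ℝ}
    (h : ∀ x, |f x| ≤ C) : |expect p f| ≤ C := by
  refine abs_le.2 ⟨?_, ?_⟩
  · rw [← expect_const p (-C)]
    exact expect_mono p fun x _ => (abs_le.1 (h x)).1
  · rw [← expect_const p C]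
    exact expect_mono p fun x _ => (abs_le.1 (h x)).2

/-- A telescoping perturbation does not change the long-run average. -/
theorem hasAverage_const_add_sub {u : ℕ → ℝ} {C : ℝ} (hu : ∀ t, |u t| ≤ C) (c : ℝ) :
    HasAverage (fun t => c + (u (t + 1) - u t)) c := by
  have h : ∀ᶠ T : ℕ in atTop,
      c + (u T - u 0) / T = timeAvg (fun t => c + (u (t + 1) - u t)) T := by
    filter_upwards [eventually_gt_atTop 0] with T hT
    have hT' : (T : ℝ) ≠ 0 := by positivity
    rw [timeAvg, Finset.sum_add_distrib, Finset.sum_range_sub]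
    simp only [Finset.sum_const, Finset.card_range, nsmul_eq_mul]
    field_simp
  refine Tendsto.congr' h ?_
  have h0 : Tendsto (fun T : ℕ => (u T - u 0) / T) atTop (𝓝 0) := by
    refine squeeze_zero_norm (a := fun T : ℕ => 2 * C / T) (fun T => ?_)
      (tendsto_const_div_atTop_nhds_zero_nat _)
    rw [Real.norm_eq_abs, abs_div, Nat.abs_cast]
    gcongr
    have := abs_sub (u T) (u 0)
    linarith [hu T, hu 0]
  simpa using h0.const_add c

/-- The law at time `t` of the Markov chain with kernel `κ` and initial law `p`. -/
noncomputable def markovLaw {X : Type*} (κ : X → PMF X) (p : PMF X) : ℕ → PMF X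
  | 0 => p
  | t + 1 => (markovLaw κ p t).bind κ

/-- The Markov operator of a kernel, acting on functions. -/
noncomputable def markovOp {X : Type*} [Fintype X] (κ : X → PMF X) :
    (X → ℝ) →ₗ[ℝ] (X → ℝ) where
  toFun f x := expect (κ x) f
  map_add' f g := funext fun x => expect_add (κ x) f g
  map_smul' c f := funext fun x => expect_const_mul (κ x) c f

theorem markovOp_apply {X : Type*} [Fintype X] (κ : X → PMF X) (f : X → ℝ) (x : X) :
    markovOp κ f x = expect (κ x) f := rfl

theorem expect_markovLaw_succ {X : Type*} [Fintype X] (κ : X → PMF X) (p : PMF X) (f : X → ℝ)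
    (t : ℕ) : expect (markovLaw κ p (t + 1)) f = expect (markovLaw κ p t) (markovOp κ f) :=
  expect_bind _ _ _

/-- The harmonic functions and the range of `T - 1` are complementary, for `T` the Markov operator
of a finite chain: if `T z - z` is harmonic then `T ^ n z = z + n • (T z - z)` stays bounded only
if `T z = z`. -/
theorem exists_harmonic_add {X : Type*} [Fintype X] (κ : X → PMF X) (f : X → ℝ) :
    ∃ k z : X → ℝ, markovOp κ k = k ∧ f = k + (markovOp κ z - z) := by
  set D : (X → ℝ) →ₗ[ℝ] (X → ℝ) := markovOp κ - 1 with hD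
  have hdisj : Disjoint (LinearMap.ker D) (LinearMap.range D) := by
    rw [Submodule.disjoint_def]
    rintro _ hy ⟨z, rfl⟩
    have hy' : markovOp κ (D z) = D z := by
      have : D (D z) = 0 := hy
      exact sub_eq_zero.1 this
    have hz : markovOp κ z = z + D z := by
      simp [hD]
    funext x
    have hgrow : ∀ n, expect (markovLaw κ (PMF.pure x) n) (D z) = D z x ∧
        expect (markovLaw κ (PMF.pure x) n) z = z x + n * D z x := by
      intro n
      induction n with
      | zero => simp [markovLaw, expect_pure]
      | succ n ih =>
        refine ⟨by rw [expect_markovLaw_succ, hy', ih.1], ?_⟩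
        rw [expect_markovLaw_succ, hz]
        change expect _ (fun w => z w + D z w) = _
        rw [expect_add, ih.1, ih.2]
        push_cast
        ring
    have hbound : ∀ w, |z w| ≤ ∑ v, |z v| := fun w =>
      Finset.single_le_sum (f := fun v => |z v|) (fun v _ => abs_nonneg _) (Finset.mem_univ w)
    -- If `D z x` were nonzero, the expectations of `z` would be unbounded in `n`.
    by_contra hne
    have hpos : 0 < |D z x| := abs_pos.2 hne
    obtain ⟨n, hn⟩ := exists_nat_gt ((2 * ∑ v, |z v|) / |D z x|)
    rw [div_lt_iff₀ hpos] at hn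
    have h1 := abs_expect_le (markovLaw κ (PMF.pure x) n) hbound
    rw [(hgrow n).2] at h1
    have h2 : |(n : ℝ) * D z x| ≤ |z x + n * D z x| + |z x| := by
      have := abs_sub (z x + n * D z x) (z x)
      rwa [add_sub_cancel_left] at this
    rw [abs_mul, Nat.abs_cast] at h2
    linarith [hbound x]
  have hcompl := (Submodule.isCompl_iff_disjoint (LinearMap.ker D) (LinearMap.range D)
    (by rw [add_comm, LinearMap.finrank_range_add_finrank_ker])).2 hdisj
  have hf : f ∈ LinearMap.ker D ⊔ LinearMap.range D := by
    rw [hcompl.sup_eq_top]; trivial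
  obtain ⟨k, hk, _, ⟨z, rfl⟩, rfl⟩ := Submodule.mem_sup.1 hf
  exact ⟨k, z, sub_eq_zero.1 hk, rfl⟩

/-- The mean ergodic theorem for finite chains: time averages converge, and the limit is a
harmonic function of the initial state. -/
theorem exists_harmonic_hasAverage {X : Type*} [Fintype X] (κ : X → PMF X) (f : X → ℝ) :
    ∃ k : X → ℝ, markovOp κ k = k ∧
      ∀ p, HasAverage (fun t => expect (markovLaw κ p t) f) (expect p k) := by
  obtain ⟨k, z, hk, rfl⟩ := exists_harmonic_add κ f
  refine ⟨k, hk, fun p => ?_⟩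
  have hkt : ∀ t, expect (markovLaw κ p t) k = expect p k := by
    intro t
    induction t with
    | zero => rfl
    | succ t ih => rw [expect_markovLaw_succ, hk, ih]
  have hbound : ∀ w, |z w| ≤ ∑ v, |z v| := fun w =>
    Finset.single_le_sum (f := fun v => |z v|) (fun v _ => abs_nonneg _) (Finset.mem_univ w)
  have h := hasAverage_const_add_sub (u := fun t => expect (markovLaw κ p t) z)
    (fun t => abs_expect_le _ hbound) (expect p k)
  convert h using 2 with t
  change expect _ (fun w => k w + (markovOp κ z w - z w)) = _
  rw [expect_add, expect_sub, hkt, expect_markovLaw_succ]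

theorem exists_isRecurrentClass_subset {S : Type*} [Finite S] (M : ArmMDP S)
    (π : SinglePolicy S) {A : Set S} (hA : A.Nonempty)
    (hcl : ∀ x ∈ A, ∀ y, Reaches M π x y → y ∈ A) :
    ∃ C, IsRecurrentClass M π C ∧ C ⊆ A := by
  -- The set of states reachable from `x` is a recurrent class once its size is minimal.
  obtain ⟨x, hx, hmin⟩ := exists_minimalFor_of_wellFoundedLT (· ∈ A)
    (fun x => {y | Reaches M π x y}.ncard) hA
  refine ⟨{y | Reaches M π x y}, ⟨⟨x, Relation.ReflTransGen.refl⟩, fun y hy z => ?_⟩,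
    fun y hy => hcl x hx y hy⟩
  have hsub : {z | Reaches M π y z} ⊆ {z | Reaches M π x z} :=
    fun z hz => Relation.ReflTransGen.trans hy hz
  have heq := Set.eq_of_subset_of_ncard_le hsub
    (hmin (hcl x hx y hy) (Set.ncard_le_ncard hsub))
  exact Set.ext_iff.1 heq z

/-- The states where a harmonic function is maximal are closed under reachability, by the maximum
principle. -/
theorem exists_isRecurrentClass_subset_argmax {S : Type*} [Fintype S] [Nonempty S] (M : ArmMDP S)
    (π : SinglePolicy S) {k : S → ℝ} (hk : markovOp (chain M π) k = k) :
    ∃ C, IsRecurrentClass M π C ∧ C ⊆ {x | ∀ y, k y ≤ k x} := by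
  refine exists_isRecurrentClass_subset M π (Finite.exists_max k) fun x hx y hy => ?_
  induction hy with
  | refl => exact hx
  | @tail u v _ huv hu =>
    have h0 : expect (chain M π u) (fun w => k u - k w) = 0 := by
      rw [expect_sub, expect_const, ← markovOp_apply, hk, sub_self]
    have h1 := (Finset.sum_eq_zero_iff_of_nonneg fun w _ =>
      mul_nonneg ENNReal.toReal_nonneg (sub_nonneg.2 (hu w))).1 h0 v (Finset.mem_univ v)
    have h2 : (chain M π u v).toReal ≠ 0 :=
      ENNReal.toReal_ne_zero.2 ⟨(PMF.mem_support_iff _ _).1 huv, PMF.apply_ne_top _ _⟩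
    have h3 : k u = k v := sub_eq_zero.1 ((mul_eq_zero.1 h1).resolve_left h2)
    intro w
    rw [← h3]
    exact hu w

/-- For a unichain arm harmonic functions are constant: the states of maximal value and those of
minimal value both contain the recurrent class. -/
theorem eq_of_harmonic {S : Type*} [Fintype S] (M : ArmMDP S) (hM : Unichain M)
    (π : SinglePolicy S) {k : S → ℝ} (hk : markovOp (chain M π) k = k) (x y : S) : k x = k y := by
  have : Nonempty S := ⟨x⟩
  obtain ⟨C, hC, hCmax⟩ := exists_isRecurrentClass_subset_argmax M π hk
  obtain ⟨C', hC', hCmin⟩ :=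
    exists_isRecurrentClass_subset_argmax M π (k := -k) (by rw [map_neg, hk])
  obtain rfl := (hM π).unique hC hC'
  obtain ⟨w, hw⟩ := hC.1
  have hmax := hCmax hw
  have hmin : ∀ v, k w ≤ k v := fun v => neg_le_neg_iff.1 (hCmin hw v)
  linarith [hmax x, hmax y, hmin x, hmin y]

theorem nonempty_of_unichain {S : Type*} (M : ArmMDP S) (hM : Unichain M) : Nonempty S := by
  obtain ⟨C, hC, -⟩ := hM fun _ => PMF.pure true
  exact hC.1.nonempty

theorem singleStateLaw_eq_markovLaw {S : Type*} (M : ArmMDP S) (π : SinglePolicy S) (s : S)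
    (t : ℕ) : singleStateLaw M π s t = markovLaw (chain M π) (PMF.pure s) t := by
  induction t with
  | zero => rfl
  | succ t ih => rw [singleStateLaw, ih, markovLaw]

/-- The law of the state-action pair when the state has law `μ` and the action follows `π`. -/
noncomputable def pairLaw {S : Type*} (π : SinglePolicy S) (μ : PMF S) : PMF (S × Bool) :=
  μ.bind fun x => (π x).map fun a => (x, a)

/-- Under a unichain arm long-run averages of a function of the state-action pair do not depend on
the initial state, and agree with the expectation under any stationary law. -/
theorem exists_hasAverage_singleLaw {S : Type*} [Fintype S] (M : ArmMDP S) (hM : Unichain M)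
    (π : SinglePolicy S) (f : S × Bool → ℝ) :
    ∃ c, (∀ s, HasAverage (fun t => expect (singleLaw M π s t) f) c) ∧
      ∀ μ, IsStationary M π μ → expect (pairLaw π μ) f = c := by
  obtain ⟨s₀⟩ := nonempty_of_unichain M hM
  set F : S → ℝ := fun x => expect ((π x).map fun a => (x, a)) f
  obtain ⟨k, hk, hlim⟩ := exists_harmonic_hasAverage (chain M π) F
  have hkc : ∀ s, k s = k s₀ := fun s => eq_of_harmonic M hM π hk s s₀
  refine ⟨k s₀, fun s => ?_, fun μ hμ => ?_⟩
  · have h := hlim (PMF.pure s)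
    rw [expect_pure, hkc] at h
    convert h using 2 with t
    rw [singleLaw, expect_bind, singleStateLaw_eq_markovLaw]
  · have hlaw : ∀ t, markovLaw (chain M π) μ t = μ := by
      intro t
      induction t with
      | zero => rfl
      | succ t ih => rw [markovLaw, ih]; exact hμ
    have h := hlim μ
    have hkμ : expect μ k = k s₀ :=
      (expect_congr μ fun s _ => hkc s).trans (expect_const μ _)
    simp only [hlaw, hkμ] at h
    have h' := hasAverage_const_add_sub (u := fun _ => 0) (C := 0) (by simp) (expect μ F)
    simp only [sub_self, add_zero] at h'
    rw [pairLaw, expect_bind]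
    exact tendsto_nhds_unique h' h

/-! ### The relaxed problem bounds the `N`-armed problem -/

theorem pairLaw_apply {S : Type*} (π : SinglePolicy S) (μ : PMF S) (s : S) (a : Bool) :
    pairLaw π μ (s, a) = μ s * π s a := by
  classical
  rw [pairLaw, PMF.bind_apply, tsum_eq_single s]
  · rw [PMF.map_apply, tsum_eq_single a]
    · simp
    · intro b hb
      simp [hb.symm]
  · intro x hx
    rw [PMF.map_apply]
    simp [hx.symm]

/-- A law of state-action pairs is a state law together with a policy. -/
theorem exists_pairLaw_eq {S : Type*} [Fintype S] (p : PMF (S × Bool)) :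
    ∃ π : SinglePolicy S, pairLaw π (p.map Prod.fst) = p := by
  classical
  have hfst : ∀ s, p.map Prod.fst s = p (s, true) + p (s, false) := by
    intro s
    rw [PMF.map_apply, tsum_fintype, Fintype.sum_prod_type, Finset.sum_eq_single s]
    · simp
    · intro x _ hx
      simp [hx.symm]
    · simp
  -- The conditional law of the action; states of mass zero may get any law.
  refine ⟨fun s => if h : p.map Prod.fst s = 0 then PMF.pure true else
    PMF.ofFintype (fun a => p (s, a) / p.map Prod.fst s) ?_, ?_⟩
  · rw [Fintype.sum_bool, ENNReal.div_add_div_same, ← hfst,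
      ENNReal.div_self h (PMF.apply_ne_top _ _)]
  · ext ⟨s, a⟩
    rw [pairLaw_apply]
    split_ifs with h
    · rw [h, zero_mul]
      rw [hfst, add_eq_zero] at h
      cases a
      · exact h.2.symm
      · exact h.1.symm
    · rw [PMF.ofFintype_apply, ENNReal.mul_div_cancel h (PMF.apply_ne_top _ _)]

theorem expect_pairLaw {S : Type*} [Fintype S] (π : SinglePolicy S) (μ : PMF S)
    (f : S × Bool → ℝ) :
    expect (pairLaw π μ) f = expect μ fun s => expect (π s) fun a => f (s, a) := by
  simp only [pairLaw, expect_bind, expect_map]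

/-- A state-action law whose state marginal is preserved by the transitions has at most the value
of an optimal policy with the same rate of activation. -/
theorem expect_reward_le {S : Type*} [Fintype S] (M : ArmMDP S)
    (hM : Unichain M) {α v : ℝ}
    (hv : ∀ π', RelaxedBudget M α π' → ∀ s v', HasAverage (singleReward M π' s) v' → v' ≤ v)
    (p : PMF (S × Bool))
    (hp : ∀ g : S → ℝ, (expect p fun w => expect (M.P w.1 w.2) g) = expect p fun w => g w.1)
    (hα : (expect p fun w => if w.2 = true then 1 else 0) = α) :
    (expect p fun w => M.r w.1 w.2) ≤ v := by
  obtain ⟨s₀⟩ := nonempty_of_unichain M hM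
  obtain ⟨π, hπ⟩ := exists_pairLaw_eq p
  have hst : IsStationary M π (p.map Prod.fst) := by
    refine pmf_ext_expect fun g => ?_
    rw [expect_map, ← hp]
    conv_rhs => rw [← hπ]
    rw [expect_pairLaw, expect_bind]
    simp only [chain, expect_bind]
  obtain ⟨c, hc, hc'⟩ := exists_hasAverage_singleLaw M hM π
    fun w => if w.2 = true then 1 else 0
  obtain ⟨d, hd, hd'⟩ := exists_hasAverage_singleLaw M hM π fun w => M.r w.1 w.2
  have h1 := hc' _ hst
  have h2 := hd' _ hst
  rw [hπ] at h1 h2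
  rw [hα] at h1
  rw [h2]
  exact hv π (fun s => h1 ▸ hc s) s₀ d (hd s₀)

/-- The expectation of `f`, averaged over the arms, of the state-action pair of an arm at
time `t`. -/
noncomputable def armMean {S : Type*} [Fintype S] (M : ArmMDP S) {N : ℕ} (σ : Policy N S)
    (s₀ : Fin N → S) (f : S × Bool → ℝ) (t : ℕ) : ℝ :=
  expect (policyLaw M σ s₀ t) fun z => (1 / N) * ∑ i, f (z.1 i, z.2 i)

theorem armMean_eq_sum {S : Type*} [Fintype S] [DecidableEq S] (M : ArmMDP S) {N : ℕ}
    (σ : Policy N S) (s₀ : Fin N → S) (f : S × Bool → ℝ) (t : ℕ) :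
    armMean M σ s₀ f t
      = ∑ w, armMean M σ s₀ (fun w' => if w' = w then 1 else 0) t * f w := by
  simp only [armMean, mul_comm _ (f _), ← expect_const_mul]
  rw [← expect_sum]
  refine congrArg (expect _) (funext fun z => ?_)
  simp only [mul_left_comm _ (1 / (N : ℝ)), ← Finset.mul_sum]
  congr 1
  simp only [Finset.mul_sum]
  rw [Finset.sum_comm]
  simp

theorem armMean_sub {S : Type*} [Fintype S] (M : ArmMDP S) {N : ℕ} (σ : Policy N S)
    (s₀ : Fin N → S) (f g : S × Bool → ℝ) (t : ℕ) :
    armMean M σ s₀ (fun w => f w - g w) t = armMean M σ s₀ f t - armMean M σ s₀ g t := by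
  simp only [armMean, Finset.sum_sub_distrib, mul_sub, expect_sub]

theorem armMean_mono {S : Type*} [Fintype S] (M : ArmMDP S) {N : ℕ} (σ : Policy N S)
    (s₀ : Fin N → S) {f g : S × Bool → ℝ} (h : ∀ w, f w ≤ g w) (t : ℕ) :
    armMean M σ s₀ f t ≤ armMean M σ s₀ g t := by
  refine expect_mono _ fun z _ => ?_
  gcongr
  exact h _

theorem armMean_const {S : Type*} [Fintype S] (M : ArmMDP S) {N : ℕ} (hN : 1 ≤ N)
    (σ : Policy N S) (s₀ : Fin N → S) (c : ℝ) (t : ℕ) :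
    armMean M σ s₀ (fun _ => c) t = c := by
  have : (N : ℝ) ≠ 0 := by positivity
  simp only [armMean, Finset.sum_const, Finset.card_univ, Fintype.card_fin, nsmul_eq_mul,
    expect_const]
  field_simp

theorem policyLaw_succ_map_fst {S : Type*} [Fintype S] (M : ArmMDP S) {N : ℕ}
    (σ : Policy N S) (s₀ : Fin N → S) (t : ℕ) :
    (policyLaw M σ s₀ (t + 1)).map Prod.fst
      = (policyLaw M σ s₀ t).bind fun z => indep fun i => M.P (z.1 i) (z.2 i) := by
  simp only [policyLaw, historyLaw, PMF.map_bind, PMF.bind_bind, PMF.map_comp,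
    PMF.bind_map, Function.comp_def]
  simp only [pmf_map_const, PMF.bind_pure]

/-- The flow balance between successive times. -/
theorem armMean_succ {S : Type*} [Fintype S] (M : ArmMDP S) {N : ℕ} (σ : Policy N S)
    (s₀ : Fin N → S) (g : S → ℝ) (t : ℕ) :
    armMean M σ s₀ (fun w => g w.1) (t + 1)
      = armMean M σ s₀ (fun w => expect (M.P w.1 w.2) g) t := by
  have h := expect_map (policyLaw M σ s₀ (t + 1)) Prod.fst fun x => (1 / (N : ℝ)) * ∑ i, g (x i)
  rw [armMean, ← h, policyLaw_succ_map_fst, expect_bind]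
  simp only [expect_const_mul, expect_sum, expect_indep_apply]
  simp only [armMean, expect_const_mul, expect_sum]

theorem armMean_activation {S : Type*} [Fintype S] (M : ArmMDP S) {N K : ℕ}
    {σ : Policy N S} {s₀ : Fin N → S} (hσ : Admissible M K s₀ σ) (t : ℕ) :
    armMean M σ s₀ (fun w => if w.2 = true then 1 else 0) t = K / N := by
  rw [armMean, ← expect_const (policyLaw M σ s₀ t) (K / N : ℝ)]
  refine expect_congr _ fun z hz => ?_
  rw [← hσ t z hz, numActive, Finset.sum_boole]
  ring

theorem timeAvg_mem_Icc {u : ℕ → ℝ} {a b : ℝ} (h : ∀ t, u t ∈ Set.Icc a b) {T : ℕ}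
    (hT : 0 < T) : timeAvg u T ∈ Set.Icc a b := by
  have hT' : (0 : ℝ) < T := by positivity
  rw [timeAvg, Set.mem_Icc, le_div_iff₀ hT', div_le_iff₀ hT']
  constructor
  · have := Finset.card_nsmul_le_sum (Finset.range T) u a fun t _ => (h t).1
    simp only [Finset.card_range, nsmul_eq_mul] at this
    linarith
  · have := Finset.sum_le_card_nsmul (Finset.range T) u b fun t _ => (h t).2
    simp only [Finset.card_range, nsmul_eq_mul] at this
    linarith

theorem hasAverage_const (c : ℝ) : HasAverage (fun _ => c) c := by
  simpa using hasAverage_const_add_sub (u := fun _ => 0) (C := 0) (by simp) c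

/-- A limit point of the time-averaged occupation measures of an admissible `N`-armed policy is a
feasible state-action law of the relaxed single-armed problem. -/
theorem limsup_timeAvg_policyReward_le {S : Type*} [Fintype S] (M : ArmMDP S) (hM : Unichain M)
    {α v : ℝ}
    (hv : ∀ π', RelaxedBudget M α π' → ∀ s v', HasAverage (singleReward M π' s) v' → v' ≤ v)
    {N K : ℕ} (hN : 1 ≤ N) (hK : (K : ℝ) = α * N) {s₀ : Fin N → S} {σ : Policy N S}
    (hσ : Admissible M K s₀ σ) :
    limsup (timeAvg (policyReward M σ s₀)) atTop ≤ v := by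
  classical
  have hN' : (N : ℝ) ≠ 0 := by positivity
  set m : (S × Bool → ℝ) → ℕ → ℝ := armMean M σ s₀ with hm
  set A : ℕ → S × Bool → ℝ := fun T w => timeAvg (m fun w' => if w' = w then 1 else 0) T with hA
  have hAf : ∀ f T, ∑ w, A T w * f w = timeAvg (m f) T := by
    intro f T
    simp only [hA, timeAvg, div_mul_eq_mul_div, ← Finset.sum_div, Finset.sum_mul]
    rw [Finset.sum_comm]
    simp only [hm, ← armMean_eq_sum]
  have hA01 : ∀ T, 0 < T → A T ∈ Set.Icc (0 : S × Bool → ℝ) 1 := by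
    have h : ∀ w t, m (fun w' => if w' = w then 1 else 0) t ∈ Set.Icc (0 : ℝ) 1 := by
      intro w t
      constructor
      · refine (armMean_const M hN σ s₀ 0 t).ge.trans (armMean_mono M σ s₀ (fun w' => ?_) t)
        split_ifs <;> norm_num
      · refine (armMean_mono M σ s₀ (fun w' => ?_) t).trans (armMean_const M hN σ s₀ 1 t).le
        split_ifs <;> norm_num
    exact fun T hT => ⟨fun w => (timeAvg_mem_Icc (h w) hT).1,
      fun w => (timeAvg_mem_Icc (h w) hT).2⟩
  have hr : policyReward M σ s₀ = m fun w => M.r w.1 w.2 := rfl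
  -- It suffices to bound every `c' < limsup`; infinitely many of the averages exceed `c'`, and
  -- their occupation measures lie in a compact set.
  refine le_of_forall_lt fun c hc => ?_
  obtain ⟨c', hcc', hc'⟩ := exists_between hc
  refine hcc'.trans_le ?_
  have hbdd : ∀ t, |m (fun w => M.r w.1 w.2) t| ≤ ∑ w : S × Bool, |M.r w.1 w.2| := by
    have hb : ∀ w : S × Bool, |M.r w.1 w.2| ≤ ∑ w : S × Bool, |M.r w.1 w.2| := fun w =>
      Finset.single_le_sum (f := fun w : S × Bool => |M.r w.1 w.2|)
        (fun v _ => abs_nonneg _) (Finset.mem_univ w)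
    refine fun t => abs_le.2 ⟨?_, ?_⟩
    · rw [← armMean_const M hN σ s₀ (-_) t]
      exact armMean_mono M σ s₀ (fun w => (abs_le.1 (hb w)).1) t
    · rw [← armMean_const M hN σ s₀ (∑ w : S × Bool, |M.r w.1 w.2|) t]
      exact armMean_mono M σ s₀ (fun w => (abs_le.1 (hb w)).2) t
  have hcob : IsCoboundedUnder (· ≤ ·) atTop (timeAvg (policyReward M σ s₀)) := by
    refine IsBoundedUnder.isCoboundedUnder_le
      (isBoundedUnder_of_eventually_ge (a := -∑ w : S × Bool, |M.r w.1 w.2|) ?_)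
    filter_upwards [eventually_gt_atTop 0] with T hT
    exact (timeAvg_mem_Icc (fun t => abs_le.1 (hbdd t)) hT).1
  have hfreq := frequently_lt_of_lt_limsup hcob hc'
  set C : Set (S × Bool → ℝ) := Set.Icc 0 1 ∩ {ν | c' ≤ ∑ w, ν w * M.r w.1 w.2} with hC
  have hCc : IsCompact C := isCompact_Icc.inter_right
    (isClosed_le continuous_const (by fun_prop))
  have hAC : ∃ᶠ T in atTop, A T ∈ C := by
    refine (hfreq.and_eventually (eventually_gt_atTop 0)).mono fun T hT => ⟨hA01 T hT.2, ?_⟩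
    rw [Set.mem_ofPred_eq, hAf fun w => M.r w.1 w.2, ← hr]
    exact hT.1.le
  obtain ⟨ν, hν, φ, hφ, hlim⟩ := hCc.tendsto_subseq' hAC
  -- The limit point inherits every time average that converges.
  have hνf : ∀ f ℓ, HasAverage (m f) ℓ → ∑ w, ν w * f w = ℓ := by
    intro f ℓ hf
    refine tendsto_nhds_unique (f := fun n => ∑ w, A (φ n) w * f w) (l := atTop)
      (tendsto_finsetSum _ fun w _ =>
        ((tendsto_pi_nhds.1 hlim w).mul_const _)) ?_
    simp only [hAf]
    exact Tendsto.comp hf hφ.tendsto_atTop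
  have hν1 : ∑ w, ν w = 1 := by
    have := hνf (fun _ => 1) 1 (by
      convert hasAverage_const 1 using 1
      exact funext fun t => armMean_const M hN σ s₀ 1 t)
    simpa using this
  have hν0 : ∀ w, 0 ≤ ν w := fun w => hν.1.1 w
  set p : PMF (S × Bool) := PMF.ofFintype (fun w => ENNReal.ofReal (ν w)) (by
    rw [← ENNReal.ofReal_sum_of_nonneg fun w _ => hν0 w, hν1, ENNReal.ofReal_one]) with hp
  have hpf : ∀ f, expect p f = ∑ w, ν w * f w := fun f => by
    simp only [expect, hp, PMF.ofFintype_apply, ENNReal.toReal_ofReal (hν0 _)]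
  -- Feasibility: the flow balance holds up to a telescoping sum, which vanishes on average.
  have key := expect_reward_le M hM hv p (fun g => ?_) ?_
  · rw [hpf] at key
    exact hν.2.trans key
  · have hg : ∀ s, |g s| ≤ ∑ s, |g s| := fun s =>
      Finset.single_le_sum (f := fun s => |g s|) (fun v _ => abs_nonneg _) (Finset.mem_univ s)
    have hb : ∀ t, |m (fun w => g w.1) t| ≤ ∑ s, |g s| := by
      refine fun t => abs_expect_le _ fun z => ?_
      rw [abs_mul, abs_of_nonneg (by positivity : (0 : ℝ) ≤ 1 / N), one_div,
        inv_mul_le_iff₀ (by positivity)]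
      refine (Finset.abs_sum_le_sum_abs _ _).trans ?_
      refine (Finset.sum_le_card_nsmul _ _ _ fun i _ => hg (z.1 i)).trans_eq ?_
      simp
    have h := hνf (fun w => expect (M.P w.1 w.2) g - g w.1) 0 (by
      convert hasAverage_const_add_sub hb 0 using 2 with t
      rw [hm, armMean_sub, armMean_succ, zero_add])
    rw [← hpf, expect_sub] at h
    linarith
  · rw [hpf]
    refine hνf _ _ ?_
    convert hasAverage_const α using 2 with t
    rw [hm, armMean_activation M hσ, hK]
    field_simp

theorem exists_numActive_eq {N K : ℕ} (h : K ≤ N) : ∃ a : Fin N → Bool, numActive a = K := by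
  obtain ⟨s, -, hs⟩ := Finset.exists_subset_card_eq
    (s := (Finset.univ : Finset (Fin N))) (n := K) (by simpa using h)
  exact ⟨fun i => decide (i ∈ s), by simpa [numActive] using hs⟩

theorem optValue_le {S : Type*} [Fintype S] (M : ArmMDP S) (hM : Unichain M) {α v : ℝ}
    (hα1 : α < 1)
    (hv : ∀ π', RelaxedBudget M α π' → ∀ s v', HasAverage (singleReward M π' s) v' → v' ≤ v)
    {N K : ℕ} (hN : 1 ≤ N) (hK : (K : ℝ) = α * N) (s₀ : Fin N → S) :
    optValue M K s₀ ≤ v := by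
  refine csSup_le ?_ ?_
  · have hKN : K ≤ N := by
      have hN' : (0 : ℝ) < N := by positivity
      have : (K : ℝ) ≤ N := by nlinarith
      exact_mod_cast this
    obtain ⟨a, ha⟩ := exists_numActive_eq hKN
    refine ⟨_, fun _ _ => PMF.pure a, fun t z hz => ?_, rfl⟩
    simp only [policyLaw, PMF.pure_map, PMF.mem_support_bind_iff, PMF.mem_support_pure_iff] at hz
    obtain ⟨h, -, rfl⟩ := hz
    exact ha
  · rintro _ ⟨σ, hσ, rfl⟩
    exact limsup_timeAvg_policyReward_le M hM hv hN hK hσ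

/-! ### The expected synchronization time -/

theorem cons_preimage_unsynced {S : Type*} [DecidableEq S] (c : (S × Bool) × (S × Bool)) :
    List.cons c ⁻¹' {l | ∀ d ∈ l, d.1 ≠ d.2}
      = if c.1 = c.2 then ∅ else {l : List ((S × Bool) × (S × Bool)) | ∀ d ∈ l, d.1 ≠ d.2} := by
  ext l
  simp only [Set.mem_preimage, Set.mem_ofPred_eq, List.forall_mem_cons]
  split_ifs with h
  · exact iff_of_false (fun h' => h'.1 h) (Set.notMem_empty l)
  · exact and_iff_right h

theorem syncTail_zero {S : Type*} [DecidableEq S] (M : ArmMDP S) (π : SinglePolicy S)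
    (c : (S × Bool) × (S × Bool)) : syncTail M π c 0 = if c.1 = c.2 then 0 else 1 := by
  rw [syncTail, lfPath, PMF.toOuterMeasure_pure_apply]
  simp only [Set.mem_ofPred_eq, List.forall_mem_singleton]
  split_ifs <;> first | rfl | contradiction

theorem syncTail_succ {S : Type*} [DecidableEq S] (M : ArmMDP S) (π : SinglePolicy S)
    (c : (S × Bool) × (S × Bool)) (t : ℕ) :
    syncTail M π c (t + 1)
      = if c.1 = c.2 then 0 else ∑' c', lfStep M π c c' * syncTail M π c' t := by
  rw [syncTail, lfPath, PMF.toOuterMeasure_bind_apply]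
  simp only [PMF.toOuterMeasure_map_apply, cons_preimage_unsynced]
  split_ifs with h
  · simp only [MeasureTheory.measure_empty, mul_zero, tsum_zero]
  · rfl

/-- First-step analysis of the expected synchronization time. -/
theorem expSyncTime_eq {S : Type*} [DecidableEq S] (M : ArmMDP S) (π : SinglePolicy S)
    (c : (S × Bool) × (S × Bool)) :
    expSyncTime M π c
      = if c.1 = c.2 then 0 else 1 + ∑' c', lfStep M π c c' * expSyncTime M π c' := by
  rw [expSyncTime, tsum_eq_zero_add' ENNReal.summable, syncTail_zero]
  simp only [syncTail_succ]
  split_ifs with h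
  · simp
  · rw [ENNReal.tsum_comm]
    simp only [ENNReal.tsum_mul_left, expSyncTime]

/-- The expected synchronization time as a real number. -/
noncomputable def syncTime {S : Type*} [DecidableEq S] (M : ArmMDP S) (π : SinglePolicy S)
    (c : (S × Bool) × (S × Bool)) : ℝ := (expSyncTime M π c).toReal

theorem syncTime_nonneg {S : Type*} [DecidableEq S] (M : ArmMDP S) (π : SinglePolicy S)
    (c : (S × Bool) × (S × Bool)) : 0 ≤ syncTime M π c := ENNReal.toReal_nonneg

theorem syncTime_le_maxSyncTime {S : Type*} [Fintype S] [DecidableEq S] (M : ArmMDP S)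
    {π : SinglePolicy S} (h : SyncAssumption M π) (c : (S × Bool) × (S × Bool)) :
    syncTime M π c ≤ maxSyncTime M π := by
  have hne : Nonempty ((S × Bool) × (S × Bool)) := ⟨c⟩
  obtain ⟨d, hd⟩ := Finite.exists_max (expSyncTime M π)
  refine ENNReal.toReal_mono ?_ (le_iSup _ c)
  exact ((iSup_le hd).trans_lt (h d)).ne

theorem syncTime_eq_zero {S : Type*} [DecidableEq S] (M : ArmMDP S) (π : SinglePolicy S)
    {c : (S × Bool) × (S × Bool)} (hc : c.1 = c.2) : syncTime M π c = 0 := by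
  rw [syncTime, expSyncTime_eq, if_pos hc, ENNReal.toReal_zero]

theorem lfStep_support_of_eq {S : Type*} [DecidableEq S] (M : ArmMDP S) (π : SinglePolicy S)
    {c d : (S × Bool) × (S × Bool)} (hc : c.1 = c.2) (hd : d ∈ (lfStep M π c).support) :
    d.1 = d.2 := by
  simp only [lfStep, couple, if_pos hc, PMF.mem_support_bind_iff, PMF.mem_support_map_iff] at hd
  obtain ⟨_, ⟨x, -, rfl⟩, a, -, rfl⟩ := hd
  rfl

/-- One step of the leader-and-follower system lowers the expected synchronization time by one,
unless the two arms are already synchronized. -/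
theorem expect_lfStep_syncTime {S : Type*} [Fintype S] [DecidableEq S] (M : ArmMDP S)
    {π : SinglePolicy S} (h : SyncAssumption M π) (c : (S × Bool) × (S × Bool)) :
    expect (lfStep M π c) (syncTime M π) = syncTime M π c - if c.1 ≠ c.2 then 1 else 0 := by
  by_cases hc : c.1 = c.2
  · rw [syncTime_eq_zero M π hc, if_neg (not_not.2 hc), sub_zero,
      ← expect_const (lfStep M π c) 0]
    exact expect_congr _ fun d hd => syncTime_eq_zero M π (lfStep_support_of_eq M π hc hd)
  · have htop : ∀ d, lfStep M π c d * expSyncTime M π d ≠ ∞ := fun d =>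
      ENNReal.mul_ne_top (PMF.apply_ne_top _ _) (h d).ne
    rw [if_pos hc, syncTime, expSyncTime_eq, if_neg hc, tsum_fintype,
      ENNReal.toReal_add ENNReal.one_ne_top (ENNReal.sum_ne_top.2 fun d _ => htop d),
      ENNReal.toReal_sum fun d _ => htop d]
    simp [expect, syncTime]

/-! ### Laws of the real and virtual processes -/

/-- The law of what happens at time `t` under FTVA. -/
noncomputable def recordLaw {S : Type*} [Fintype S] [DecidableEq S] (M : ArmMDP S)
    (π : SinglePolicy S) (μ : PMF S) {N : ℕ} (ρ : TieRule N S) (s₀ : Fin N → S) (t : ℕ) :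
    PMF (Record N S) :=
  (ftvaHistoryLaw M π μ ρ s₀ t).bind fun h =>
    (ftvaActions π ρ h.1 h.2.1 h.2.2).map fun ba => (h.2.1, h.2.2, ba.1, ba.2)

/-- The real and the virtual state-action pair of arm `i`. -/
def armPairs {N : ℕ} {S : Type*} (z : Record N S) (i : Fin N) : (S × Bool) × (S × Bool) :=
  ((z.1 i, z.2.2.2 i), (z.2.1 i, z.2.2.1 i))

/-- The same as `armPairs`, but with the virtual action in place of the real one: the real arm does
what the virtual arm advises. -/
def advisedPairs {N : ℕ} {S : Type*} (z : Record N S) (i : Fin N) : (S × Bool) × (S × Bool) :=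
  ((z.1 i, z.2.2.1 i), (z.2.1 i, z.2.2.1 i))

theorem ftvaLaw_eq_map {S : Type*} [Fintype S] [DecidableEq S] (M : ArmMDP S)
    (π : SinglePolicy S) (μ : PMF S) {N : ℕ} (ρ : TieRule N S) (s₀ : Fin N → S) (t : ℕ) :
    ftvaLaw M π μ ρ s₀ t = (recordLaw M π μ ρ s₀ t).map fun z => (z.1, z.2.2.2) := by
  simp only [ftvaLaw, recordLaw, PMF.map_bind, PMF.map_comp, Function.comp_def]

theorem ftvaActions_map_fst {N : ℕ} {S Y : Type*} (π : SinglePolicy S) (ρ : TieRule N S)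
    (h : List (Record N S)) (x y : Fin N → S) (g : (Fin N → Bool) → Y) :
    ((ftvaActions π ρ h x y).map fun ba => g ba.1) = (indep fun i => π (y i)).map g := by
  simp only [ftvaActions, PMF.map_bind, PMF.map_comp, Function.comp_def, pmf_map_const]
  exact PMF.bind_pure_comp _ _

theorem indep_lfStep {S : Type*} [Fintype S] [DecidableEq S] (M : ArmMDP S)
    (π : SinglePolicy S) {N : ℕ} (c : Fin N → (S × Bool) × (S × Bool)) :
    (indep fun i => lfStep M π (c i))
      = (indep fun i => couple M (c i).1 (c i).2).bind fun q =>
          (indep fun i => π (q i).2).map fun b i => (((q i).1, b i), ((q i).2, b i)) := by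
  simp only [lfStep]
  rw [← indep_bind]
  refine congrArg _ (funext fun q => ?_)
  rw [← indep_map]

/-- From one time to the next, each arm makes a step of the leader-and-follower system, provided
that it takes the virtual action at the later time. -/
theorem recordLaw_succ_map_advisedPairs {S : Type*} [Fintype S] [DecidableEq S] (M : ArmMDP S)
    (π : SinglePolicy S) (μ : PMF S) {N : ℕ} (ρ : TieRule N S) (s₀ : Fin N → S) (t : ℕ) :
    (recordLaw M π μ ρ s₀ (t + 1)).map advisedPairs
      = (recordLaw M π μ ρ s₀ t).bind fun z => indep fun i => lfStep M π (armPairs z i) := by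
  simp only [recordLaw, ftvaHistoryLaw, PMF.map_bind, PMF.bind_bind, PMF.map_comp, PMF.bind_map,
    Function.comp_def, indep_lfStep, armPairs]
  refine congrArg _ (funext fun h => congrArg _ (funext fun ba => congrArg _ (funext fun q => ?_)))
  exact ftvaActions_map_fst π ρ _ _ _ fun b i => (((q i).1, b i), ((q i).2, b i))

theorem couple_map_snd {S : Type*} [DecidableEq S] (M : ArmMDP S) (z w : S × Bool) :
    (couple M z w).map Prod.snd = M.P w.1 w.2 := by
  rw [couple]
  split_ifs with h
  · rw [PMF.map_comp, h]
    exact PMF.map_id _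
  · simp only [PMF.map_bind, PMF.map_comp, Function.comp_def]
    rw [PMF.bind_const]
    exact PMF.map_id _

theorem lfStep_map_snd {S : Type*} [DecidableEq S] (M : ArmMDP S) (π : SinglePolicy S)
    (c : (S × Bool) × (S × Bool)) :
    (lfStep M π c).map Prod.snd = pairLaw π (M.P c.2.1 c.2.2) := by
  rw [← couple_map_snd M c.1 c.2, pairLaw, lfStep, PMF.bind_map]
  simp only [PMF.map_bind, PMF.map_comp, Function.comp_def]

theorem pairLaw_bind_step {S : Type*} (M : ArmMDP S) {π : SinglePolicy S} {μ : PMF S}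
    (hμ : IsStationary M π μ) :
    ((pairLaw π μ).bind fun w => pairLaw π (M.P w.1 w.2)) = pairLaw π μ := by
  conv_rhs => rw [← hμ]
  simp only [pairLaw, PMF.bind_bind, PMF.bind_map, Function.comp_def, chain]

/-- At every time the virtual state-action pairs of the arms are i.i.d. with the stationary law. -/
theorem recordLaw_map_virtual {S : Type*} [Fintype S] [DecidableEq S] (M : ArmMDP S)
    {π : SinglePolicy S} {μ : PMF S} (hμ : IsStationary M π μ) {N : ℕ} (ρ : TieRule N S)
    (s₀ : Fin N → S) (t : ℕ) :
    ((recordLaw M π μ ρ s₀ t).map fun z i => (z.2.1 i, z.2.2.1 i))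
      = indep fun _ => pairLaw π μ := by
  induction t with
  | zero =>
    simp only [recordLaw, ftvaHistoryLaw, PMF.map_bind, PMF.bind_map, PMF.map_comp,
      Function.comp_def, pairLaw]
    rw [← indep_bind]
    refine congrArg _ (funext fun y => ?_)
    rw [← indep_map]
    exact ftvaActions_map_fst π ρ _ _ _ fun b i => (y i, b i)
  | succ t ih =>
    have h := congrArg (PMF.map fun c (i : Fin N) => (c i).2)
      (recordLaw_succ_map_advisedPairs M π μ ρ s₀ t)
    rw [PMF.map_comp, PMF.map_bind] at h
    simp only [indep_map _ fun _ : Fin N => (Prod.snd : (S × Bool) × (S × Bool) → S × Bool),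
      lfStep_map_snd] at h
    refine h.trans ?_
    have h2 := indep_bind (fun _ : Fin N => pairLaw π μ) fun _ w => pairLaw π (M.P w.1 w.2)
    simp only [pairLaw_bind_step M hμ] at h2
    rw [← h2, ← ih, PMF.bind_map]
    rfl

theorem recordLaw_valid {S : Type*} [Fintype S] [DecidableEq S] (M : ArmMDP S)
    (π : SinglePolicy S) (μ : PMF S) {N K : ℕ} {ρ : TieRule N S} (hρ : ρ.Valid K)
    (s₀ : Fin N → S) (t : ℕ) {z : Record N S} (hz : z ∈ (recordLaw M π μ ρ s₀ t).support) :
    numActive z.2.2.2 = K ∧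
      (K ≤ numActive z.2.2.1 → ∀ i, z.2.2.2 i = true → z.2.2.1 i = true) ∧
      (numActive z.2.2.1 < K → ∀ i, z.2.2.1 i = true → z.2.2.2 i = true) := by
  simp only [recordLaw, ftvaActions, PMF.mem_support_bind_iff, PMF.mem_support_map_iff] at hz
  obtain ⟨h, -, _, ⟨b, -, a, ha, rfl⟩, rfl⟩ := hz
  exact hρ _ _ _ _ a ha

/-! ### Disagreements and unsynchronized arms -/

theorem numActive_eq_sum {N : ℕ} (a : Fin N → Bool) :
    (numActive a : ℝ) = ∑ i, if a i = true then 1 else 0 := by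
  rw [numActive, Finset.sum_boole]

/-- The number of arms whose real and virtual actions differ is `|∑ i, b i - K|`. -/
theorem sum_disagree_eq {N K : ℕ} {a b : Fin N → Bool} (ha : numActive a = K)
    (h1 : K ≤ numActive b → ∀ i, a i = true → b i = true)
    (h2 : numActive b < K → ∀ i, b i = true → a i = true) :
    (∑ i, if a i ≠ b i then (1 : ℝ) else 0) = |(numActive b : ℝ) - K| := by
  rcases le_or_gt K (numActive b) with h | h
  · rw [abs_of_nonneg (sub_nonneg.2 (by exact_mod_cast h)), ← ha, numActive_eq_sum,
      numActive_eq_sum, ← Finset.sum_sub_distrib]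
    refine Finset.sum_congr rfl fun i _ => ?_
    have := h1 h i
    cases hai : a i <;> cases hbi : b i <;> simp_all
  · rw [abs_sub_comm, abs_of_nonneg (sub_nonneg.2 (by exact_mod_cast h.le)), ← ha,
      numActive_eq_sum, numActive_eq_sum, ← Finset.sum_sub_distrib]
    refine Finset.sum_congr rfl fun i _ => ?_
    have := h2 h i
    cases hai : a i <;> cases hbi : b i <;> simp_all

/-- The expected number of arms whose real and virtual actions differ is at most the standard
deviation of the number of virtual activations, which is `√(α (1 - α) N)`. -/
theorem expect_disagree_le {S : Type*} [Fintype S] [DecidableEq S] (M : ArmMDP S)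
    {π : SinglePolicy S} {μ : PMF S} (hμ : IsStationary M π μ) {α : ℝ}
    (hα : (expect (pairLaw π μ) fun w => if w.2 = true then 1 else 0) = α)
    {N K : ℕ} (hK : (K : ℝ) = α * N) {ρ : TieRule N S} (hρ : ρ.Valid K) (s₀ : Fin N → S)
    (t : ℕ) :
    (expect (recordLaw M π μ ρ s₀ t) fun z => ∑ i, if z.2.2.2 i ≠ z.2.2.1 i then (1 : ℝ) else 0)
      ≤ Real.sqrt N / 2 := by
  set h : S × Bool → ℝ := fun w => (if w.2 = true then 1 else 0) - α with hh
  have h0 : expect (pairLaw π μ) h = 0 := by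
    rw [hh, expect_sub, hα, expect_const, sub_self]
  have hsq : (expect (pairLaw π μ) fun w => h w ^ 2) ≤ 1 / 4 := by
    -- The variance is `α (1 - α) ≤ 1 / 4`, as the square of an indicator is itself.
    have e : (fun w => h w ^ 2)
        = fun w => (1 - 2 * α) * (if w.2 = true then 1 else 0) + α ^ 2 := by
      funext w
      simp only [hh]
      split_ifs <;> ring
    rw [e, expect_add, expect_const_mul, hα, expect_const]
    nlinarith [sq_nonneg (α - 1 / 2)]
  have hD : (expect (recordLaw M π μ ρ s₀ t) fun z =>
      ∑ i, if z.2.2.2 i ≠ z.2.2.1 i then (1 : ℝ) else 0)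
        = expect (indep fun _ : Fin N => pairLaw π μ) fun f => |∑ i, h (f i)| := by
    rw [← recordLaw_map_virtual M hμ ρ s₀ t, expect_map]
    refine expect_congr _ fun z hz => ?_
    obtain ⟨h1, h2, h3⟩ := recordLaw_valid M π μ hρ s₀ t hz
    rw [sum_disagree_eq h1 h2 h3, numActive_eq_sum, hK]
    simp only [hh, Finset.sum_sub_distrib, Finset.sum_const, Finset.card_univ,
      Fintype.card_fin, nsmul_eq_mul, mul_comm α]
  rw [hD]
  have hmain := sq_expect_le (indep fun _ : Fin N => pairLaw π μ) fun f => |∑ i, h (f i)|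
  simp only [sq_abs] at hmain
  rw [expect_indep_sum_sq _ h fun _ => h0] at hmain
  simp only [Finset.sum_const, Finset.card_univ, Fintype.card_fin, nsmul_eq_mul] at hmain
  refine abs_le_of_sq_le_sq' ?_ (by positivity) |>.2
  rw [div_pow, Real.sq_sqrt (Nat.cast_nonneg N)]
  have : (N : ℝ) * (expect (pairLaw π μ) fun w => h w ^ 2) ≤ N * (1 / 4) := by gcongr
  linarith

/-- The expected total of the expected synchronization times of the arms. -/
noncomputable def potential {S : Type*} [Fintype S] [DecidableEq S] (M : ArmMDP S)
    (π : SinglePolicy S) (μ : PMF S) {N : ℕ} (ρ : TieRule N S) (s₀ : Fin N → S) (t : ℕ) : ℝ :=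
  expect (recordLaw M π μ ρ s₀ t) fun z => ∑ i, syncTime M π (armPairs z i)

/-- The expected number of arms whose real and virtual state-action pairs differ. -/
noncomputable def unsynced {S : Type*} [Fintype S] [DecidableEq S] (M : ArmMDP S)
    (π : SinglePolicy S) (μ : PMF S) {N : ℕ} (ρ : TieRule N S) (s₀ : Fin N → S) (t : ℕ) : ℝ :=
  expect (recordLaw M π μ ρ s₀ t) fun z =>
    ∑ i, if (armPairs z i).1 ≠ (armPairs z i).2 then 1 else 0

theorem potential_nonneg {S : Type*} [Fintype S] [DecidableEq S] (M : ArmMDP S)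
    (π : SinglePolicy S) (μ : PMF S) {N : ℕ} (ρ : TieRule N S) (s₀ : Fin N → S) (t : ℕ) :
    0 ≤ potential M π μ ρ s₀ t := by
  rw [← expect_const (recordLaw M π μ ρ s₀ t) 0]
  exact expect_mono _ fun z _ => Finset.sum_nonneg fun i _ => syncTime_nonneg M π _

theorem potential_le {S : Type*} [Fintype S] [DecidableEq S] (M : ArmMDP S)
    {π : SinglePolicy S} (hsync : SyncAssumption M π) (μ : PMF S) {N : ℕ} (ρ : TieRule N S)
    (s₀ : Fin N → S) (t : ℕ) : potential M π μ ρ s₀ t ≤ N * maxSyncTime M π := by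
  rw [← expect_const (recordLaw M π μ ρ s₀ t) (N * maxSyncTime M π)]
  refine expect_mono _ fun z _ => ?_
  refine (Finset.sum_le_card_nsmul _ _ _ fun i _ =>
    syncTime_le_maxSyncTime M hsync (armPairs z i)).trans_eq ?_
  simp

/-- The drift of the potential: each unsynchronized arm lowers it by one, and each arm whose new
real and virtual actions differ raises it by at most the maximal synchronization time. -/
theorem potential_succ_le {S : Type*} [Fintype S] [DecidableEq S] (M : ArmMDP S)
    {π : SinglePolicy S} (hsync : SyncAssumption M π) (μ : PMF S) {N : ℕ} (ρ : TieRule N S)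
    (s₀ : Fin N → S) (t : ℕ) :
    potential M π μ ρ s₀ (t + 1) ≤ potential M π μ ρ s₀ t - unsynced M π μ ρ s₀ t
      + maxSyncTime M π * expect (recordLaw M π μ ρ s₀ (t + 1)) fun z =>
          ∑ i, if z.2.2.2 i ≠ z.2.2.1 i then (1 : ℝ) else 0 := by
  have h1 : ∀ (z : Record N S) i, syncTime M π (armPairs z i) ≤ syncTime M π (advisedPairs z i)
      + maxSyncTime M π * if z.2.2.2 i ≠ z.2.2.1 i then (1 : ℝ) else 0 := by
    intro z i
    split_ifs with h
    · have := syncTime_nonneg M π (advisedPairs z i)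
      linarith [syncTime_le_maxSyncTime M hsync (armPairs z i)]
    · have : armPairs z i = advisedPairs z i := by
        rw [armPairs, advisedPairs, not_not.1 h]
      rw [this, mul_zero, add_zero]
  have h2 : (expect (recordLaw M π μ ρ s₀ (t + 1)) fun z =>
      ∑ i, syncTime M π (advisedPairs z i))
        = potential M π μ ρ s₀ t - unsynced M π μ ρ s₀ t := by
    rw [← expect_map _ advisedPairs fun c => ∑ i, syncTime M π (c i),
      recordLaw_succ_map_advisedPairs, expect_bind, potential, unsynced, ← expect_sub]
    refine congrArg _ (funext fun z => ?_)
    simp only [expect_sum, expect_indep_apply, expect_lfStep_syncTime M hsync,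
      Finset.sum_sub_distrib]
  rw [← h2, ← expect_const_mul, ← expect_add]
  refine expect_mono _ fun z _ => ?_
  rw [Finset.mul_sum, ← Finset.sum_add_distrib]
  exact Finset.sum_le_sum fun i _ => h1 z i

/-- The drift inequality summed over time; the potential starts at most at `N` times the maximal
synchronization time, whatever the initial real states. -/
theorem sum_unsynced_le {S : Type*} [Fintype S] [DecidableEq S] (M : ArmMDP S)
    {π : SinglePolicy S} (hsync : SyncAssumption M π) {μ : PMF S} (hμ : IsStationary M π μ)
    {α : ℝ} (hα : (expect (pairLaw π μ) fun w => if w.2 = true then 1 else 0) = α)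
    {N K : ℕ} (hK : (K : ℝ) = α * N) {ρ : TieRule N S} (hρ : ρ.Valid K) (s₀ : Fin N → S)
    (T : ℕ) :
    ∑ t ∈ Finset.range T, unsynced M π μ ρ s₀ t
      ≤ N * maxSyncTime M π + T * (maxSyncTime M π * (Real.sqrt N / 2)) := by
  have hτ : 0 ≤ maxSyncTime M π := ENNReal.toReal_nonneg
  have h : ∀ t, unsynced M π μ ρ s₀ t ≤ potential M π μ ρ s₀ t - potential M π μ ρ s₀ (t + 1)
      + maxSyncTime M π * (Real.sqrt N / 2) := by
    intro t
    have h1 := potential_succ_le M hsync μ ρ s₀ t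
    have h2 := mul_le_mul_of_nonneg_left (expect_disagree_le M hμ hα hK hρ s₀ (t + 1)) hτ
    linarith
  refine (Finset.sum_le_sum fun t _ => h t).trans ?_
  rw [Finset.sum_add_distrib, Finset.sum_range_sub']
  simp only [Finset.sum_const, Finset.card_range, nsmul_eq_mul]
  linarith [potential_nonneg M π μ ρ s₀ T, potential_le M hsync μ ρ s₀ 0]

/-! ### The long-run average reward -/

theorem abs_reward_le_rMax {S : Type*} [Finite S] (M : ArmMDP S) (s : S) (a : Bool) :
    |M.r s a| ≤ rMax M :=
  le_ciSup (f := fun z : S × Bool => |M.r z.1 z.2|) (Set.finite_range _).bddAbove (s, a)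

theorem rMax_nonneg {S : Type*} (M : ArmMDP S) : 0 ≤ rMax M :=
  Real.iSup_nonneg fun _ => abs_nonneg _

theorem abs_armReward_le {S : Type*} [Finite S] (M : ArmMDP S) {N : ℕ} (hN : 1 ≤ N)
    (x : Fin N → S) (a : Fin N → Bool) : |armReward M x a| ≤ rMax M := by
  rw [armReward, abs_mul, abs_of_nonneg (by positivity : (0 : ℝ) ≤ 1 / N), one_div,
    inv_mul_le_iff₀ (by positivity)]
  refine (Finset.abs_sum_le_sum_abs _ _).trans ?_
  refine (Finset.sum_le_card_nsmul _ _ _ fun i _ => abs_reward_le_rMax M (x i) (a i)).trans_eq ?_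
  simp

/-- The rewards of the real and the virtual process differ only through the unsynchronized arms. -/
theorem sub_unsynced_le_ftvaReward {S : Type*} [Fintype S] [DecidableEq S] (M : ArmMDP S)
    {π : SinglePolicy S} {μ : PMF S} (hμ : IsStationary M π μ) {N : ℕ} (hN : 1 ≤ N)
    (ρ : TieRule N S) (s₀ : Fin N → S) (t : ℕ) :
    (expect (pairLaw π μ) fun w => M.r w.1 w.2) - 2 * rMax M / N * unsynced M π μ ρ s₀ t
      ≤ ftvaReward M π μ ρ s₀ t := by
  have hN' : (N : ℝ) ≠ 0 := by positivity
  have hv : (expect (recordLaw M π μ ρ s₀ t) fun z => armReward M z.2.1 z.2.2.1)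
      = expect (pairLaw π μ) fun w => M.r w.1 w.2 := by
    have h := expect_map (recordLaw M π μ ρ s₀ t) (fun z i => (z.2.1 i, z.2.2.1 i))
      fun f => (1 / (N : ℝ)) * ∑ i, M.r (f i).1 (f i).2
    rw [recordLaw_map_virtual M hμ, expect_const_mul, expect_sum] at h
    simp only [expect_indep_apply (fun _ : Fin N => pairLaw π μ) _ fun w => M.r w.1 w.2,
      Finset.sum_const, Finset.card_univ, Fintype.card_fin, nsmul_eq_mul] at h
    rw [← mul_assoc, one_div_mul_cancel hN', one_mul] at h
    exact h.symm
  rw [ftvaReward, ftvaLaw_eq_map, expect_map, ← hv, unsynced, ← expect_const_mul, ← expect_sub]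
  refine expect_mono _ fun z _ => ?_
  have h : ∀ i, M.r (z.2.1 i) (z.2.2.1 i)
      - 2 * rMax M * (if (armPairs z i).1 ≠ (armPairs z i).2 then 1 else 0)
        ≤ M.r (z.1 i) (z.2.2.2 i) := by
    intro i
    split_ifs with h
    · have h1 := abs_le.1 (abs_reward_le_rMax M (z.2.1 i) (z.2.2.1 i))
      have h2 := abs_le.1 (abs_reward_le_rMax M (z.1 i) (z.2.2.2 i))
      linarith [h1.2, h2.1]
    · have h' := Prod.ext_iff.1 (not_not.1 h)
      simp only [armPairs] at h'
      rw [h'.1, h'.2, mul_zero, sub_zero]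
  have hs := Finset.sum_le_sum fun i (_ : i ∈ Finset.univ) => h i
  rw [Finset.sum_sub_distrib, ← Finset.mul_sum] at hs
  have hs' := mul_le_mul_of_nonneg_left hs (by positivity : (0 : ℝ) ≤ 1 / N)
  simp only [armReward]
  refine le_trans (le_of_eq ?_) hs'
  ring

/-- The gap in value is at most the long-run fraction of unsynchronized arms times `2 * rMax`; the
number of unsynchronized arms is on average at most the rate `√N / 2` of new disagreements times
the maximal synchronization time. -/
theorem sub_ftvaValue_le {S : Type*} [Fintype S] [DecidableEq S] (M : ArmMDP S)
    {π : SinglePolicy S} (hsync : SyncAssumption M π) {μ : PMF S} (hμ : IsStationary M π μ)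
    {α : ℝ} (hα : (expect (pairLaw π μ) fun w => if w.2 = true then 1 else 0) = α)
    {N K : ℕ} (hN : 1 ≤ N) (hK : (K : ℝ) = α * N) {ρ : TieRule N S} (hρ : ρ.Valid K)
    (s₀ : Fin N → S) :
    (expect (pairLaw π μ) fun w => M.r w.1 w.2) - ftvaValue M π μ ρ s₀
      ≤ rMax M * maxSyncTime M π / Real.sqrt N := by
  set V := expect (pairLaw π μ) fun w => M.r w.1 w.2 with hV
  set L := V - rMax M * maxSyncTime M π / Real.sqrt N with hL
  have hN' : (0 : ℝ) < N := by positivity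
  have hr := rMax_nonneg M
  have hlow : ∀ T : ℕ, 0 < T →
      L - 2 * rMax M * maxSyncTime M π / T ≤ timeAvg (ftvaReward M π μ ρ s₀) T := by
    intro T hT
    have hT' : (0 : ℝ) < T := by positivity
    have h1 := Finset.sum_le_sum fun t (_ : t ∈ Finset.range T) =>
      sub_unsynced_le_ftvaReward M hμ hN ρ s₀ t
    rw [Finset.sum_sub_distrib, ← Finset.mul_sum] at h1
    simp only [Finset.sum_const, Finset.card_range, nsmul_eq_mul, ← hV] at h1
    have h2 := mul_le_mul_of_nonneg_left (sum_unsynced_le M hsync hμ hα hK hρ s₀ T)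
      (by positivity : 0 ≤ 2 * rMax M / N)
    rw [timeAvg, le_div_iff₀ hT']
    refine le_trans (le_of_eq ?_) ((sub_le_sub_left h2 _).trans h1)
    have hdiv : 2 * rMax M / N * (T * (maxSyncTime M π * (Real.sqrt N / 2)))
        = T * (rMax M * maxSyncTime M π / Real.sqrt N) := by
      rw [div_mul_eq_mul_div, div_eq_iff hN'.ne']
      rw [show T * (rMax M * maxSyncTime M π / Real.sqrt N) * N
        = T * (rMax M * maxSyncTime M π) * (N / Real.sqrt N) by ring, Real.div_sqrt]
      ring
    rw [mul_add, hdiv, hL]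
    field_simp
    ring
  have hlim : Tendsto (fun T : ℕ => L - 2 * rMax M * maxSyncTime M π / T) atTop (𝓝 L) := by
    simpa using (tendsto_const_div_atTop_nhds_zero_nat
      (2 * rMax M * maxSyncTime M π)).const_sub L
  have hup : IsCoboundedUnder (· ≥ ·) atTop (timeAvg (ftvaReward M π μ ρ s₀)) := by
    refine IsBoundedUnder.isCoboundedUnder_ge
      (isBoundedUnder_of_eventually_le (a := rMax M) ?_)
    have hb : ∀ t, ftvaReward M π μ ρ s₀ t ∈ Set.Icc (-rMax M) (rMax M) := fun t =>
      abs_le.1 (abs_expect_le (ftvaLaw M π μ ρ s₀ t) fun z => abs_armReward_le M hN z.1 z.2)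
    filter_upwards [eventually_gt_atTop 0] with T hT
    exact (timeAvg_mem_Icc hb hT).2
  have h : L ≤ ftvaValue M π μ ρ s₀ := by
    rw [← hlim.liminf_eq, ftvaValue]
    exact liminf_le_liminf ((eventually_gt_atTop 0).mono hlow) hlim.isBoundedUnder_ge hup
  linarith

/-- With a Markov tie-breaking rule the pair of the real and the virtual states is a finite Markov
chain, so that the averages converge. -/
theorem hasAverage_ftvaReward {S : Type*} [Fintype S] [DecidableEq S] (M : ArmMDP S)
    (π : SinglePolicy S) (μ : PMF S) {N : ℕ} {ρ : TieRule N S} (hρ : ρ.Markov)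
    (s₀ : Fin N → S) :
    HasAverage (ftvaReward M π μ ρ s₀) (ftvaValue M π μ ρ s₀) := by
  obtain ⟨g, hg⟩ := hρ
  set act : (Fin N → S) × (Fin N → S) → PMF ((Fin N → Bool) × (Fin N → Bool)) :=
    fun w => ftvaActions π ρ [] w.1 w.2 with hact
  have hA : ∀ h x y, ftvaActions π ρ h x y = act (x, y) := fun h x y => by
    simp only [hact, ftvaActions, hg]
  set κ : (Fin N → S) × (Fin N → S) → PMF ((Fin N → S) × (Fin N → S)) := fun w =>
    (act w).bind fun ba => (indep fun i => couple M (w.1 i, ba.2 i) (w.2 i, ba.1 i)).map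
      fun q => (fun i => (q i).1, fun i => (q i).2) with hκ
  set p : PMF ((Fin N → S) × (Fin N → S)) := (indep fun _ : Fin N => μ).map fun y => (s₀, y)
    with hp
  have hlaw : ∀ t, (ftvaHistoryLaw M π μ ρ s₀ t).map Prod.snd = markovLaw κ p t := by
    intro t
    induction t with
    | zero => simp only [ftvaHistoryLaw, PMF.map_comp, Function.comp_def, markovLaw, hp]
    | succ t ih =>
      rw [markovLaw, ← ih, PMF.bind_map]
      simp only [ftvaHistoryLaw, PMF.map_bind, PMF.map_comp, Function.comp_def, hA, hκ]
  obtain ⟨k, -, hk⟩ := exists_harmonic_hasAverage κ fun w =>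
    expect (act w) fun ba => armReward M w.1 ba.2
  have hreward : ftvaReward M π μ ρ s₀ = fun t => expect (markovLaw κ p t) fun w =>
      expect (act w) fun ba => armReward M w.1 ba.2 := by
    funext t
    have : ftvaLaw M π μ ρ s₀ t
        = (markovLaw κ p t).bind fun w => (act w).map fun ba => (w.1, ba.2) := by
      rw [← hlaw, PMF.bind_map]
      simp only [ftvaLaw, hA, Function.comp_def]
    rw [ftvaReward, this, expect_bind]
    simp only [expect_map]
  have h := hk p
  rw [← hreward] at h
  rwa [ftvaValue, Tendsto.liminf_eq h]

end RestlessBandit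

open RestlessBandit
theorem theorem1 {S : Type*} [Fintype S] [DecidableEq S] (M : ArmMDP S) (hM : Unichain M)
    (α : ℝ) (hα0 : 0 < α) (hα1 : α < 1)
    (π : SinglePolicy S) (hπ : RelaxedBudget M α π) (hsync : SyncAssumption M π) :
    ∃ V₁ : ℝ, (∀ s, HasAverage (singleReward M π s) V₁) ∧
      ∀ (N K : ℕ), 1 ≤ N → (K : ℝ) = α * N →
        ∀ (μ : PMF S), IsStationary M π μ →
        ∀ (ρ : TieRule N S), ρ.Valid K →
        ∀ s₀ : Fin N → S,
          (ρ.Markov → HasAverage (ftvaReward M π μ ρ s₀) (ftvaValue M π μ ρ s₀)) ∧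
          V₁ - ftvaValue M π μ ρ s₀ ≤ rMax M * maxSyncTime M π / Real.sqrt N ∧
          (IsOptimalSingle M α π → ∀ s₁ : Fin N → S,
            optValue M K s₁ - ftvaValue M π μ ρ s₀ ≤ V₁ - ftvaValue M π μ ρ s₀ ∧
            V₁ - ftvaValue M π μ ρ s₀ ≤ rMax M * maxSyncTime M π / Real.sqrt N) := by
  obtain ⟨s⟩ := nonempty_of_unichain M hM
  obtain ⟨V₁, hV, hVμ⟩ := exists_hasAverage_singleLaw M hM π fun w => M.r w.1 w.2
  obtain ⟨β, hβ, hβμ⟩ := exists_hasAverage_singleLaw M hM π fun w => if w.2 = true then 1 else 0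
  obtain rfl : β = α := tendsto_nhds_unique (hβ s) (hπ s)
  refine ⟨V₁, hV, fun N K hN hK μ hμ ρ hρ s₀ => ?_⟩
  have hbound : V₁ - ftvaValue M π μ ρ s₀ ≤ rMax M * maxSyncTime M π / Real.sqrt N := by
    rw [← hVμ μ hμ]
    exact sub_ftvaValue_le M hsync hμ (hβμ μ hμ) hN hK hρ s₀
  refine ⟨fun h => hasAverage_ftvaReward M π μ h s₀, hbound, fun hopt s₁ => ⟨?_, hbound⟩⟩
  obtain ⟨-, v, hv, hmax⟩ := hopt
  obtain rfl : v = V₁ := tendsto_nhds_unique (hv s) (hV s)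
  exact sub_le_sub_right (optValue_le M hM hα1 hmax hN hK s₁) _
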